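/- Let $\Omega\subset\mathbb R^d$ be a bounded open set. Let $BV(\Omega)$ be the space of functions $\phi\in L^1(\Omega)$ whose distributional gradient is a finite $\mathbb R^d$-valued Borel measure $D\phi$ on $\Omega$, i.e. $\int_\Omega \phi\,\nabla\psi\,dx=-\int_\Omega\psi\,dD\phi$ for all $\psi\in C_c^\infty(\Omega)$, and let $|D\phi|$ be the total variation measure of $D\phi$ (with respect to the Euclidean norm). Let $\phi\in BV(\Omega)$ and let $f\in L^1(\Omega,|D\phi|)$ with $f\ge 1$ $|D\phi|$-a.e. Then there exists a sequence $\{\phi_k\}_{k\in\mathbb N}\subset BV(\Omega)$ such that $\phi_k\to\phi$ in $L^1(\Omega)$ and \[ \lim_{k\to+\infty}|D\phi_k|(E)=\int_E f\,d|D\phi| \] for every Borel set $E\subset\subset\Omega$ (that is, $\overline E$ is a compact subset of $\Omega$) with $|D\phi|(\partial E)=0$. The sequence does not depend on $E$. -/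

import Mathlib

open MeasureTheory Set Filter Topology
open scoped ENNReal ContDiff Gradient

/-- The Euclidean space `ℝ^d`. -/
abbrev Rd (d : ℕ) : Type := EuclideanSpace ℝ (Fin d)

/-- `D` is the distributional gradient of `u` on `Ω`: a (finite) `ℝ^d`-valued Borel measure
carried by `Ω` with `∫_Ω u ∇ψ dx = -∫_Ω ψ dD` for all `ψ ∈ C_c^∞(Ω)`. -/
structure HasGradMeasure {d : ℕ} (Ω : Set (Rd d)) (u : Rd d → ℝ)
    (D : VectorMeasure (Rd d) (Rd d)) : Prop where
  restrict_eq : D.restrict Ω = D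
  integral_eq : ∀ ψ : Rd d → ℝ, ContDiff ℝ ∞ ψ → HasCompactSupport ψ → tsupport ψ ⊆ Ω →
    ∫ x in Ω, u x • ∇ ψ x = -∫ᵛ x, ψ x ∂•D

/-- `u ∈ BV(Ω)`: `u ∈ L¹(Ω)` and its distributional gradient is a finite `ℝ^d`-valued
measure on `Ω`. -/
def MemBV {d : ℕ} (Ω : Set (Rd d)) (u : Rd d → ℝ) : Prop :=
  IntegrableOn u Ω volume ∧ ∃ D, HasGradMeasure Ω u D

open Classical in
/-- The distributional gradient `Du` of `u ∈ BV(Ω)`, extended by zero outside `Ω`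
(junk value `0` if the distributional gradient is not a measure). -/
noncomputable def gradMeasure {d : ℕ} (Ω : Set (Rd d)) (u : Rd d → ℝ) :
    VectorMeasure (Rd d) (Rd d) :=
  if h : ∃ D, HasGradMeasure Ω u D then h.choose else 0

/-- The total variation measure `|Du|` of `u ∈ BV(Ω)`, with respect to the Euclidean norm. -/
noncomputable def totalVar {d : ℕ} (Ω : Set (Rd d)) (u : Rd d → ℝ) : Measure (Rd d) :=
  (gradMeasure Ω u).variation

/-- The `i`-th component of an `ℝ^d`-valued measure. -/
noncomputable def gradComp {d : ℕ} (D : VectorMeasure (Rd d) (Rd d)) (i : Fin d) :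
    SignedMeasure (Rd d) :=
  D.mapRange (EuclideanSpace.proj i : Rd d →L[ℝ] ℝ).toLinearMap.toAddMonoidHom
    (EuclideanSpace.proj i : Rd d →L[ℝ] ℝ).continuous

theorem gradComp_apply {d : ℕ} (D : VectorMeasure (Rd d) (Rd d)) (i : Fin d) (s : Set (Rd d)) :
    gradComp D i s = D s i := rfl

theorem isFiniteMeasure_variation_signed {d : ℕ} (ν : SignedMeasure (Rd d)) :
    IsFiniteMeasure ν.variation := by
  rw [← SignedMeasure.totalVariation_eq_variation]
  unfold SignedMeasure.totalVariation
  infer_instance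

/-- An `ℝ^d`-valued measure has finite total variation. -/
theorem isFiniteMeasure_variation {d : ℕ} (D : VectorMeasure (Rd d) (Rd d)) :
    IsFiniteMeasure D.variation := by
  have hle : D.variation ≤ ∑ i, (gradComp D i).variation := by
    apply VectorMeasure.variation_le_of_forall_enorm_le
    intro s hs
    have h1 : D s = ∑ i, EuclideanSpace.single i (D s i) := by
      ext j
      simp [Finset.sum_apply, Pi.single_apply]
    calc ‖D s‖ₑ = ‖∑ i, EuclideanSpace.single i (D s i)‖ₑ := by rw [← h1]
      _ ≤ ∑ i, ‖EuclideanSpace.single i (D s i)‖ₑ := enorm_sum_le _ _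
      _ ≤ ∑ i, (gradComp D i).variation s := by
        refine Finset.sum_le_sum fun i _ => ?_
        have h2 : ‖(EuclideanSpace.single i (D s i) : Rd d)‖ₑ = ‖gradComp D i s‖ₑ := by
          rw [gradComp_apply, enorm_eq_iff_norm_eq]
          simp
        rw [h2]
        exact VectorMeasure.enorm_measure_le_variation _ _
      _ = (∑ i, (gradComp D i).variation) s := by simp
  have : ∀ i, IsFiniteMeasure (gradComp D i).variation :=
    fun i => isFiniteMeasure_variation_signed _
  exact isFiniteMeasure_of_le _ hle

theorem integral_gradComp {d : ℕ} (D : VectorMeasure (Rd d) (Rd d)) (i : Fin d)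
    {ψ : Rd d → ℝ} (hψ : Integrable ψ D.variation) :
    (∫ᵛ x, ψ x ∂•D) i = ∫ᵛ x, ψ x ∂•(gradComp D i) := by
  have hfin := isFiniteMeasure_variation D
  have hle : (gradComp D i).variation ≤ D.variation := by
    apply VectorMeasure.variation_le_of_forall_enorm_le
    intro s hs
    refine le_trans ?_ (VectorMeasure.enorm_measure_le_variation _ _)
    rw [gradComp_apply, enorm_le_iff_norm_le]
    exact PiLp.norm_apply_le _ _
  have hfin' := isFiniteMeasure_variation_signed (gradComp D i)
  apply hψ.induction (P := fun ψ : Rd d → ℝ =>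
    (∫ᵛ x, ψ x ∂•D) i = ∫ᵛ x, ψ x ∂•(gradComp D i))
  · intro c s hs _
    rw [VectorMeasure.integral_indicator_const _ hs, VectorMeasure.integral_indicator_const _ hs]
    simp [gradComp_apply]
  · intro f g _ hf hg h1 h2
    simp only [Pi.add_apply]
    rw [VectorMeasure.integral_fun_add hf hg,
      VectorMeasure.integral_fun_add (hf.mono_measure hle) (hg.mono_measure hle),
      PiLp.add_apply, h1, h2]
  · apply isClosed_eq
    · exact (EuclideanSpace.proj i : Rd d →L[ℝ] ℝ).continuous.comp
        VectorMeasure.continuous_integral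
    · rw [continuous_iff_continuousAt]
      intro f₀
      refine VectorMeasure.tendsto_integral_of_L1 _
        ((Lp.aestronglyMeasurable f₀).mono_measure hle)
        (Eventually.of_forall fun g => (L1.integrable_coeFn g).mono_measure hle) ?_
      have hlim : Tendsto (fun g : Rd d →₁[D.variation] ℝ =>
          ∫⁻ x, ‖g x - f₀ x‖ₑ ∂D.variation) (𝓝 f₀) (𝓝 0) := by
        have := (Lp.tendsto_Lp_iff_tendsto_eLpNorm' (fun g : Rd d →₁[D.variation] ℝ => g) f₀).1
          tendsto_id
        simpa [eLpNorm_one_eq_lintegral_enorm] using this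
      exact tendsto_of_tendsto_of_tendsto_of_le_of_le tendsto_const_nhds hlim
        (fun _ => zero_le) (fun _ => lintegral_mono' hle le_rfl)
  · intro f g hfg _ hf
    rw [← VectorMeasure.integral_congr_ae hfg, hf]
    exact VectorMeasure.integral_congr_ae (ae_mono hle hfg)

theorem signed_eq_zero {d : ℕ} {Ω : Set (Rd d)} (hΩ : IsOpen Ω) (ν : SignedMeasure (Rd d))
    (h0 : ν.restrict Ω = ν)
    (h : ∀ ψ : Rd d → ℝ, ContDiff ℝ ∞ ψ → HasCompactSupport ψ → tsupport ψ ⊆ Ω →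
      ∫ᵛ x, ψ x ∂•ν = 0) : ν = 0 := by
  have hJ := ν.toSignedMeasure_toJordanDecomposition
  set J := ν.toJordanDecomposition
  set p := J.posPart
  set n := J.negPart
  have hν : ν = p.toSignedMeasure - n.toSignedMeasure := hJ.symm
  have hp : p ≪ p + n := Measure.AbsolutelyContinuous.rfl.add_right _
  have hn : n ≪ p + n := by
    rw [add_comm]; exact Measure.AbsolutelyContinuous.rfl.add_right _
  have hip : Integrable (fun x => (p.rnDeriv (p + n) x).toReal) (p + n) :=
    Measure.integrable_toReal_rnDeriv
  have hin : Integrable (fun x => (n.rnDeriv (p + n) x).toReal) (p + n) :=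
    Measure.integrable_toReal_rnDeriv
  have hflip : (ContinuousLinearMap.lsmul ℝ ℝ : ℝ →L[ℝ] ℝ →L[ℝ] ℝ) =
      (ContinuousLinearMap.lsmul ℝ ℝ : ℝ →L[ℝ] ℝ →L[ℝ] ℝ).flip := by
    ext; simp
  have hae : ∀ᵐ x ∂(p + n), x ∈ Ω →
      (p.rnDeriv (p + n) x).toReal - (n.rnDeriv (p + n) x).toReal = 0 := by
    refine hΩ.ae_eq_zero_of_integral_contDiff_smul_eq_zero
      ((hip.sub hin).locallyIntegrable.locallyIntegrableOn _) ?_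
    intro ψ h1 h2 h3
    have hψ : ∀ m : Measure (Rd d), IsFiniteMeasure m → Integrable ψ m :=
      fun m _ => h1.continuous.integrable_of_hasCompactSupport h2
    have h4 := h ψ h1 h2 h3
    rw [hν, VectorMeasure.integral_sub_vectorMeasure
      (by simpa [VectorMeasure.Integrable] using hψ p inferInstance)
      (by simpa [VectorMeasure.Integrable] using hψ n inferInstance), hflip,
      VectorMeasure.integral_toSignedMeasure, VectorMeasure.integral_toSignedMeasure] at h4
    have h5 : ∀ m : Measure (Rd d), IsFiniteMeasure m → m ≪ p + n →
        ∫ x, ψ x * (m.rnDeriv (p + n) x).toReal ∂(p + n) = ∫ x, ψ x ∂m ∧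
        Integrable (fun x => ψ x * (m.rnDeriv (p + n) x).toReal) (p + n) := by
      intro m hm hac
      have : m.HaveLebesgueDecomposition (p + n) :=
        Measure.haveLebesgueDecomposition_of_sigmaFinite m (p + n)
      constructor
      · rw [← integral_rnDeriv_smul hac]
        simp [mul_comm]
      · have := (integrable_rnDeriv_smul_iff hac (f := ψ)).2 (hψ m hm)
        simpa [mul_comm] using this
    simp only [smul_eq_mul, mul_sub]
    rw [integral_sub (h5 p inferInstance hp).2 (h5 n inferInstance hn).2,
      (h5 p inferInstance hp).1, (h5 n inferInstance hn).1, h4]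
  have hpn : ∀ s, MeasurableSet s → s ⊆ Ω → p s = n s := by
    intro s hs hsΩ
    have e1 := Measure.withDensity_rnDeriv_eq _ _ hp
    have e2 := Measure.withDensity_rnDeriv_eq _ _ hn
    conv_lhs => rw [← e1]
    conv_rhs => rw [← e2]
    rw [withDensity_apply _ hs, withDensity_apply _ hs]
    refine setLIntegral_congr_fun_ae hs ?_
    filter_upwards [hae, Measure.rnDeriv_lt_top p (p + n), Measure.rnDeriv_lt_top n (p + n)]
      with x hx hx1 hx2 hxs
    exact (ENNReal.toReal_eq_toReal_iff' hx1.ne hx2.ne).1 (sub_eq_zero.1 (hx (hsΩ hxs)))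
  ext s hs
  rw [← h0, VectorMeasure.restrict_apply _ hΩ.measurableSet hs, hν]
  have hm := hs.inter hΩ.measurableSet
  simp [Measure.toSignedMeasure_apply_measurable hm, measureReal_def,
    hpn _ hm inter_subset_right]

/-- The distributional gradient is unique. -/
theorem HasGradMeasure.unique {d : ℕ} {Ω : Set (Rd d)} (hΩ : IsOpen Ω) {u : Rd d → ℝ}
    {D₁ D₂ : VectorMeasure (Rd d) (Rd d)} (h₁ : HasGradMeasure Ω u D₁)
    (h₂ : HasGradMeasure Ω u D₂) : D₁ = D₂ := by
  have key : ∀ i, gradComp D₁ i - gradComp D₂ i = 0 := by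
    intro i
    refine signed_eq_zero hΩ _ ?_ ?_
    · ext s hs
      rw [VectorMeasure.restrict_apply _ hΩ.measurableSet hs]
      simp only [sub_apply, gradComp_apply]
      rw [← VectorMeasure.restrict_apply D₁ hΩ.measurableSet hs, h₁.restrict_eq,
        ← VectorMeasure.restrict_apply D₂ hΩ.measurableSet hs, h₂.restrict_eq]
    · intro ψ a b c
      have hψ : ∀ m : Measure (Rd d), IsFiniteMeasure m → Integrable ψ m :=
        fun m _ => a.continuous.integrable_of_hasCompactSupport b
      rw [VectorMeasure.integral_sub_vectorMeasure
        (hψ _ (isFiniteMeasure_variation_signed _)) (hψ _ (isFiniteMeasure_variation_signed _)),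
        ← integral_gradComp _ _ (hψ _ (isFiniteMeasure_variation _)),
        ← integral_gradComp _ _ (hψ _ (isFiniteMeasure_variation _)),
        ← neg_inj.1 ((h₁.integral_eq ψ a b c).symm.trans (h₂.integral_eq ψ a b c)), sub_self]
  ext s hs i
  have := congrArg (fun ν : SignedMeasure (Rd d) => ν s) (key i)
  simpa [gradComp_apply, sub_eq_zero] using this

theorem HasGradMeasure.gradMeasure_eq {d : ℕ} {Ω : Set (Rd d)} (hΩ : IsOpen Ω) {u : Rd d → ℝ}
    {D : VectorMeasure (Rd d) (Rd d)} (h : HasGradMeasure Ω u D) : gradMeasure Ω u = D := by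
  have hex : ∃ D, HasGradMeasure Ω u D := ⟨D, h⟩
  rw [gradMeasure, dif_pos hex]
  exact hex.choose_spec.unique hΩ h

/-! Ripples along the level sets of a function multiply the size of its gradient by a prescribed
factor h ≥ 1 while hardly moving the function in L¹. For smooth u take v = u + e h Z(u/e), where Z
is bounded and Z' = z is mostly close to ±1. Up to O(e), ∇v = (1 + h z(u/e)) ∇u. For z = ±1 and h ≥
1 one has |1 + hz| = h + z, so |∇v| is nearly (h + z(u/e)) |∇u|, and the term z(u/e) |∇u| vanishes
weakly as e → 0 because z has mean zero. This is `exists_oscillation`, and it is where the bound f ≥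
1 is needed. The weak vanishing (`tendsto_integral_oscillation_mul_norm_gradient`) is an integration
by parts, since z(u/e) ∂u = ∂(e Z(u/e)).

To reach a general φ in BV, `exists_smooth_approx` replaces φ by cut-off mollifications whose
measures |∇u| dx converge vaguely to |Dφ| on a given compact set, and `exists_smooth_one_le_approx`
replaces f by a C¹ function h ≥ 1. `exists_approx_of_finset` combines these into one approximation
that is correct against finitely many test functions. Letting the finite sets exhaust the countable
family of `exists_countable_test_family` yields a single sequence, and the portmanteau argument
`tendsto_measure_of_tendsto_lintegral_test` passes to every E whose boundary is null for |Dφ|, hence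
for f |Dφ|. -/

/-! ### Densities and polar decomposition of vector measures. -/

/-- Integration against a vector measure given by a density. -/
theorem integral_withDensityᵥ_eq_integral_smul {d : ℕ} {m : Measure (Rd d)} {σ : Rd d → Rd d}
    (hσ : Integrable σ m) {ψ : Rd d → ℝ} (hψ : Integrable ψ (m.withDensityᵥ σ).variation) :
    ∫ᵛ x, ψ x ∂•(m.withDensityᵥ σ) = ∫ x, ψ x • σ x ∂m := by
  have hσe : AEMeasurable (fun x => ‖σ x‖ₑ) m := hσ.aestronglyMeasurable.enorm
  have hvar := Measure.variation_withDensityᵥ hσ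
  have hint : ∀ g : Rd d → ℝ, Integrable g (m.withDensityᵥ σ).variation →
      Integrable (fun x => g x • σ x) m := by
    intro g hg
    rw [hvar, integrable_withDensity_iff_integrable_smul₀' hσe (by simp)] at hg
    -- The function g is controlled only for the variation ‖σ‖ m, and may be wild where σ = 0.
    -- Writing g σ as (‖σ‖ g) times the normalised field avoids that set.
    have h1 : AEStronglyMeasurable (fun x => ‖σ x‖⁻¹ • σ x) m :=
      hσ.aestronglyMeasurable.norm.inv₀.smul hσ.aestronglyMeasurable
    have h2 : (fun x => g x • σ x) = fun x => (‖σ x‖ₑ.toReal • g x) • (‖σ x‖⁻¹ • σ x) := by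
      ext1 x
      by_cases h0 : σ x = 0
      · simp [h0]
      · rw [smul_smul, smul_eq_mul, toReal_enorm, mul_comm, ← mul_assoc,
          inv_mul_cancel₀ (norm_ne_zero_iff.2 h0), one_mul]
    rw [h2]
    refine hg.norm.mono' (hg.1.smul h1) (Eventually.of_forall fun x => ?_)
    rw [norm_smul]
    refine mul_le_of_le_one_right (norm_nonneg _) ?_
    rw [norm_smul, norm_inv, norm_norm]
    exact inv_mul_le_one
  have hfin := isFiniteMeasure_variation (m.withDensityᵥ σ)
  refine hψ.induction (P := fun ψ : Rd d → ℝ =>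
    ∫ᵛ x, ψ x ∂•(m.withDensityᵥ σ) = ∫ x, ψ x • σ x ∂m) ?_ ?_ ?_ ?_
  · intro c s hs _
    rw [VectorMeasure.integral_indicator_const _ hs, withDensityᵥ_apply hσ hs]
    have : (fun x => (s.indicator (fun _ => c) x) • σ x) = s.indicator (fun x => c • σ x) := by
      ext1 x; by_cases hx : x ∈ s <;> simp [hx]
    rw [this, integral_indicator hs, integral_smul]
    simp
  · intro f g _ hf hg h1 h2
    simp only [Pi.add_apply, add_smul]
    rw [VectorMeasure.integral_fun_add hf hg, integral_add (hint f hf) (hint g hg), h1, h2]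
  · apply isClosed_eq VectorMeasure.continuous_integral
    rw [continuous_iff_continuousAt]
    intro f₀
    refine tendsto_integral_of_L1 _ (hint _ (L1.integrable_coeFn f₀)).1
      (Eventually.of_forall fun g => hint _ (L1.integrable_coeFn g)) ?_
    have hlim : Tendsto (fun g : Rd d →₁[(m.withDensityᵥ σ).variation] ℝ =>
        ∫⁻ x, ‖g x - f₀ x‖ₑ ∂(m.withDensityᵥ σ).variation) (𝓝 f₀) (𝓝 0) := by
      have := (Lp.tendsto_Lp_iff_tendsto_eLpNorm'
        (fun g : Rd d →₁[(m.withDensityᵥ σ).variation] ℝ => g) f₀).1 tendsto_id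
      simpa [eLpNorm_one_eq_lintegral_enorm] using this
    refine hlim.congr fun g => ?_
    have hm : AEMeasurable (fun x => ‖g x - f₀ x‖ₑ) (m.withDensity fun x => ‖σ x‖ₑ) := by
      rw [← hvar]
      exact ((Lp.aestronglyMeasurable g).sub (Lp.aestronglyMeasurable f₀)).enorm
    have he : ∀ F : Rd d → ℝ≥0∞, ∫⁻ x, F x ∂(m.withDensityᵥ σ).variation =
        ∫⁻ x, F x ∂(m.withDensity fun x => ‖σ x‖ₑ) := fun F => by rw [hvar]
    rw [he, lintegral_withDensity_eq_lintegral_mul₀' hσe hm]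
    refine lintegral_congr fun x => ?_
    rw [← sub_smul, enorm_smul, mul_comm]; rfl
  · intro f g hfg _ hf
    rw [← VectorMeasure.integral_congr_ae hfg, hf]
    refine integral_congr_ae ?_
    rw [hvar] at hfg
    have := (ae_withDensity_iff' hσe).1 hfg
    filter_upwards [this] with x hx
    by_cases h0 : σ x = 0
    · simp [h0]
    · rw [hx (by simpa using h0)]

/-- Polar decomposition of an `ℝ^d`-valued measure. -/
theorem exists_density_variation {d : ℕ} (M : VectorMeasure (Rd d) (Rd d)) :
    ∃ σ : Rd d → Rd d, Integrable σ M.variation ∧ M.variation.withDensityᵥ σ = M ∧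
      ∀ᵐ x ∂M.variation, ‖σ x‖ = 1 := by
  have hfin := isFiniteMeasure_variation M
  set μ := M.variation with hμ
  have hac : ∀ i, gradComp M i ≪ᵥ μ.toENNRealVectorMeasure := by
    intro i
    refine VectorMeasure.AbsolutelyContinuous.mk fun s hs h0 => ?_
    rw [Measure.toENNRealVectorMeasure_apply_measurable hs] at h0
    have h1 := VectorMeasure.enorm_measure_le_variation M s
    rw [← hμ, h0] at h1
    have h2 : M s = 0 := by simpa using h1
    simp [gradComp_apply, h2]
  set σ : Rd d → Rd d := fun x => WithLp.toLp 2 fun i => (gradComp M i).rnDeriv μ x with hσ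
  have hint : Integrable σ μ := by
    have h1 : Integrable (fun x => fun i => (gradComp M i).rnDeriv μ x) μ :=
      Integrable.of_eval fun i => SignedMeasure.integrable_rnDeriv _ _
    exact (PiLp.continuousLinearEquiv 2 ℝ (fun _ : Fin d => ℝ)).symm.toContinuousLinearMap.integrable_comp h1
  have hM : μ.withDensityᵥ σ = M := by
    ext s hs i
    rw [withDensityᵥ_apply hint hs, ← gradComp_apply M i,
      ← SignedMeasure.withDensityᵥ_rnDeriv_eq _ _ (hac i),
      withDensityᵥ_apply (SignedMeasure.integrable_rnDeriv _ _) hs]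
    exact ((EuclideanSpace.proj i : Rd d →L[ℝ] ℝ).integral_comp_comm hint.integrableOn).symm
  refine ⟨σ, hint, hM, ?_⟩
  -- Taking variations in M = σ μ gives μ = ‖σ‖ μ, and uniqueness of densities forces ‖σ‖ = 1.
  have h1 := Measure.variation_withDensityᵥ hint
  rw [hM, ← hμ] at h1
  have h2 : μ.withDensity 1 = μ.withDensity fun x => ‖σ x‖ₑ := by rw [withDensity_one, ← h1]
  have h3 := (withDensity_eq_iff aemeasurable_one hint.aestronglyMeasurable.enorm
    (by simp [measure_ne_top])).1 h2
  filter_upwards [h3] with x hx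
  have := congrArg ENNReal.toReal hx
  simpa using this.symm

/-! ### Compactly supported C¹ functions as BV functions. -/

theorem continuous_gradient {d : ℕ} {v : Rd d → ℝ} (hv : ContDiff ℝ 1 v) :
    Continuous (∇ v) :=
  (InnerProductSpace.toDual ℝ (Rd d)).symm.continuous.comp (hv.continuous_fderiv one_ne_zero)

theorem tsupport_gradient_subset {d : ℕ} (v : Rd d → ℝ) : tsupport (∇ v) ⊆ tsupport v := by
  refine closure_minimal (fun x hx => ?_) (isClosed_tsupport v)
  refine support_fderiv_subset ℝ (f := v) ?_
  intro h
  apply hx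
  simp [gradient, h]

theorem hasCompactSupport_gradient {d : ℕ} {v : Rd d → ℝ} (hv : HasCompactSupport v) :
    HasCompactSupport (∇ v) :=
  hv.mono' ((subset_tsupport _).trans (tsupport_gradient_subset v))

theorem integrable_gradient {d : ℕ} {v : Rd d → ℝ} (hv : ContDiff ℝ 1 v)
    (hc : HasCompactSupport v) : Integrable (∇ v) volume :=
  (continuous_gradient hv).integrable_of_hasCompactSupport (hasCompactSupport_gradient hc)

theorem integral_smul_gradient {d : ℕ} {v ψ : Rd d → ℝ} (hv : ContDiff ℝ 1 v)
    (hc : HasCompactSupport v) (hψ : ContDiff ℝ 1 ψ) :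
    ∫ x, v x • ∇ ψ x = -∫ x, ψ x • ∇ v x := by
  have i1 : Integrable (fun x => v x • ∇ ψ x) volume :=
    (hv.continuous.smul (continuous_gradient hψ)).integrable_of_hasCompactSupport hc.smul_right
  have i2 : Integrable (fun x => ψ x • ∇ v x) volume :=
    (hψ.continuous.smul (continuous_gradient hv)).integrable_of_hasCompactSupport
      (hasCompactSupport_gradient hc).smul_left
  refine ext_inner_left ℝ fun e => ?_
  rw [inner_neg_right, ← integral_inner i1, ← integral_inner i2]
  have c1 : Continuous fun x => fderiv ℝ v x e :=
    (hv.continuous_fderiv one_ne_zero).clm_apply continuous_const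
  have c2 : Continuous fun x => fderiv ℝ ψ x e :=
    (hψ.continuous_fderiv one_ne_zero).clm_apply continuous_const
  have hc1 : HasCompactSupport fun x => fderiv ℝ v x e := by
    exact hc.fderiv_apply (𝕜 := ℝ) e
  have := integral_mul_fderiv_eq_neg_fderiv_mul_of_integrable (μ := (volume : Measure (Rd d)))
    (f := v) (g := ψ) (v := e)
    ((c1.mul hψ.continuous).integrable_of_hasCompactSupport hc1.mul_right)
    ((hv.continuous.mul c2).integrable_of_hasCompactSupport hc.mul_right)
    ((hv.continuous.mul hψ.continuous).integrable_of_hasCompactSupport hc.mul_right)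
    (fun x _ => hv.contDiffAt.differentiableAt one_ne_zero)
    (fun x _ => hψ.contDiffAt.differentiableAt one_ne_zero)
  have hg : ∀ (w : Rd d → ℝ) (x : Rd d), inner ℝ e (∇ w x) = fderiv ℝ w x e := fun w x => by
    rw [real_inner_comm, inner_gradient_left]
  simp only [inner_smul_right, hg, this]
  simp only [mul_comm]

theorem hasGradMeasure_of_contDiff {d : ℕ} {Ω : Set (Rd d)} (hΩ : IsOpen Ω) {v : Rd d → ℝ}
    (hv : ContDiff ℝ 1 v) (hc : HasCompactSupport v) (hs : tsupport v ⊆ Ω) :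
    HasGradMeasure Ω v ((volume : Measure (Rd d)).withDensityᵥ (∇ v)) := by
  have hi := integrable_gradient hv hc
  constructor
  · ext1 s hs'
    rw [VectorMeasure.restrict_apply _ hΩ.measurableSet hs',
      withDensityᵥ_apply hi hs', withDensityᵥ_apply hi (hs'.inter hΩ.measurableSet)]
    refine (setIntegral_eq_of_subset_of_forall_sdiff_eq_zero hs' inter_subset_left fun x hx => ?_).symm
    refine image_eq_zero_of_notMem_tsupport fun h => hx.2 ⟨hx.1, hs ?_⟩
    exact tsupport_gradient_subset v h
  · intro ψ h1 h2 h3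
    have hψ : Integrable ψ ((volume : Measure (Rd d)).withDensityᵥ (∇ v)).variation := by
      have := isFiniteMeasure_variation ((volume : Measure (Rd d)).withDensityᵥ (∇ v))
      exact h1.continuous.integrable_of_hasCompactSupport h2
    rw [integral_withDensityᵥ_eq_integral_smul hi hψ,
      ← integral_smul_gradient hv hc (h1.of_le (by simp))]
    refine setIntegral_eq_integral_of_forall_compl_eq_zero fun x hx => ?_
    rw [image_eq_zero_of_notMem_tsupport fun h => hx (hs h), zero_smul]

theorem memBV_of_contDiff {d : ℕ} {Ω : Set (Rd d)} (hΩ : IsOpen Ω) {v : Rd d → ℝ}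
    (hv : ContDiff ℝ 1 v) (hc : HasCompactSupport v) (hs : tsupport v ⊆ Ω) : MemBV Ω v :=
  ⟨(hv.continuous.integrable_of_hasCompactSupport hc).integrableOn, _,
    hasGradMeasure_of_contDiff hΩ hv hc hs⟩

theorem totalVar_of_contDiff {d : ℕ} {Ω : Set (Rd d)} (hΩ : IsOpen Ω) {v : Rd d → ℝ}
    (hv : ContDiff ℝ 1 v) (hc : HasCompactSupport v) (hs : tsupport v ⊆ Ω) :
    totalVar Ω v = (volume : Measure (Rd d)).withDensity fun x => ‖∇ v x‖ₑ := by
  rw [totalVar, (hasGradMeasure_of_contDiff hΩ hv hc hs).gradMeasure_eq hΩ,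
    Measure.variation_withDensityᵥ (integrable_gradient hv hc)]

/-! ### Mean-zero waves and their weak vanishing along level sets. -/

/-- Vanishing mean makes the primitive itself periodic, so it is bounded by its maximum over one
period. -/
theorem exists_bounded_primitive {g : ℝ → ℝ} (hg : Continuous g) {T : ℝ} (hT : 0 < T)
    (hper : Function.Periodic g T) (h0 : ∫ t in 0..T, g t = 0) :
    ∃ (G : ℝ → ℝ) (B : ℝ), G 0 = 0 ∧ (∀ t, HasDerivAt G (g t) t) ∧ ∀ t, |G t| ≤ B := by
  have hd : ∀ t, HasDerivAt (fun t => ∫ s in 0..t, g s) (g t) t := fun t =>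
    (hg.integral_hasStrictDerivAt 0 t).hasDerivAt
  have hP : Function.Periodic (fun t => ∫ s in 0..t, g s) T := by
    intro t
    have := intervalIntegral.integral_add_adjacent_intervals
      (hg.intervalIntegrable (μ := volume) 0 t) (hg.intervalIntegrable t (t + T))
    simp only
    rw [← this, hper.intervalIntegral_add_eq t 0, zero_add, h0, add_zero]
  have hc : Continuous fun t => ∫ s in 0..t, g s :=
    continuous_iff_continuousAt.2 fun t => (hd t).continuousAt
  obtain ⟨B, hB⟩ := (isCompact_Icc (a := (0 : ℝ)) (b := T)).exists_bound_of_continuousOn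
    hc.continuousOn
  refine ⟨_, B, by simp, hd, fun t => ?_⟩
  obtain ⟨s, hs, hst⟩ := hP.exists_mem_Ico₀ hT t
  rw [hst]
  exact hB s (Ico_subset_Icc_self hs)

theorem continuous_smoothed_sign_sin {a : ℝ} (ha : 0 < a) :
    Continuous fun t => Real.sin t / (|Real.sin t| + a) :=
  Real.continuous_sin.div (by fun_prop) fun t => by positivity

/-- There are continuous mean-zero waves with values in `[-1, 1]` that are mostly close to `±1`. -/
theorem exists_wave {η : ℝ} (hη : 0 < η) :
    ∃ (z Z W : ℝ → ℝ) (B κ : ℝ), Continuous z ∧ (∀ t, |z t| ≤ 1) ∧ Z 0 = 0 ∧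
      (∀ t, HasDerivAt Z (z t) t) ∧ (∀ t, |Z t| ≤ B) ∧ κ ≤ η ∧
      (∀ t, HasDerivAt W (1 - z t ^ 2 - κ) t) ∧ (∀ t, |W t| ≤ B) := by
  -- A continuous regularisation of sign(sin t). As a → 0, 1 - y² tends to 0 wherever sin t ≠ 0, so
  -- its mean becomes small by dominated convergence.
  set y : ℝ → ℝ → ℝ := fun a t => Real.sin t / (|Real.sin t| + a) with hy
  have hle : ∀ a, 0 < a → ∀ t, |y a t| ≤ 1 := by
    intro a ha t
    rw [hy, abs_div, abs_of_pos (by positivity : 0 < |Real.sin t| + a), div_le_one (by positivity)]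
    linarith
  have hlim : Tendsto (fun n : ℕ => ∫ t in 0..(2 * Real.pi), (1 - y (1 / ((n : ℝ) + 1)) t ^ 2))
      atTop (𝓝 (∫ t in 0..(2 * Real.pi), (0 : ℝ))) := by
    refine intervalIntegral.tendsto_integral_filter_of_dominated_convergence (fun _ => 1)
      (Eventually.of_forall fun n => ?_) (Eventually.of_forall fun n => ?_) (by simp) ?_
    · have := continuous_smoothed_sign_sin (Nat.one_div_pos_of_nat (α := ℝ) (n := n))
      exact (continuous_const.sub (this.pow 2)).aestronglyMeasurable
    · refine Eventually.of_forall fun t _ => ?_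
      have := sq_le_one_iff_abs_le_one _ |>.2 (hle _ (Nat.one_div_pos_of_nat (α := ℝ) (n := n)) t)
      rw [Real.norm_eq_abs, abs_le]
      constructor <;> nlinarith [sq_nonneg (y (1 / ((n : ℝ) + 1)) t)]
    · have hz : {t : ℝ | Real.sin t = 0}.Countable := by
        refine (countable_range fun n : ℤ => (n : ℝ) * Real.pi).mono fun t ht => ?_
        obtain ⟨n, hn⟩ := Real.sin_eq_zero_iff.1 ht
        exact ⟨n, hn⟩
      filter_upwards [hz.ae_notMem volume] with t ht _
      have hs : Real.sin t ≠ 0 := ht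
      have h1 : Tendsto (fun n : ℕ => y (1 / ((n : ℝ) + 1)) t) atTop
          (𝓝 (Real.sin t / (|Real.sin t| + 0))) :=
        tendsto_const_nhds.div (tendsto_const_nhds.add tendsto_one_div_add_atTop_nhds_zero_nat)
          (by simpa using hs)
      have h2 := (tendsto_const_nhds (x := (1 : ℝ))).sub (h1.pow 2)
      have h3 : 1 - (Real.sin t / (|Real.sin t| + 0)) ^ 2 = 0 := by
        rw [add_zero, div_pow, sq_abs, div_self (pow_ne_zero 2 hs), sub_self]
      rwa [h3] at h2
  rw [intervalIntegral.integral_zero] at hlim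
  obtain ⟨n, hn⟩ := (hlim.eventually (gt_mem_nhds (show 0 < η * (2 * Real.pi) by positivity))).exists
  set a : ℝ := 1 / ((n : ℝ) + 1) with ha
  have ha0 : 0 < a := Nat.one_div_pos_of_nat
  have hc : Continuous (y a) := continuous_smoothed_sign_sin ha0
  have hper : Function.Periodic (y a) (2 * Real.pi) := fun t => by simp [hy]
  have hpi : (0 : ℝ) < 2 * Real.pi := by positivity
  -- Shift the period to [-π, π], where oddness applies.
  have hmean : ∫ t in 0..(2 * Real.pi), y a t = 0 := by
    have h1 := hper.intervalIntegral_add_eq 0 (-Real.pi)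
    rw [zero_add] at h1
    have h2 : -Real.pi + 2 * Real.pi = Real.pi := by ring
    rw [h1, h2]
    have h3 := intervalIntegral.integral_comp_neg (a := -Real.pi) (b := Real.pi) (y a)
    rw [neg_neg] at h3
    have h4 : (fun t => y a (-t)) = fun t => -y a t := by
      ext1 t; simp [hy, neg_div]
    rw [h4, intervalIntegral.integral_neg] at h3
    linarith
  obtain ⟨Z, B₁, hZ0, hZ, hZB⟩ := exists_bounded_primitive hc hpi hper hmean
  -- The mean of 1 - y²; subtracting it leaves a mean-zero wave, which again has a bounded
  -- primitive.
  set κ : ℝ := (∫ t in 0..(2 * Real.pi), (1 - y a t ^ 2)) / (2 * Real.pi) with hκ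
  have hc2 : Continuous fun t => 1 - y a t ^ 2 := by fun_prop
  obtain ⟨W, B₂, -, hW, hWB⟩ := exists_bounded_primitive (g := fun t => 1 - y a t ^ 2 - κ)
    (by fun_prop) hpi (fun t => by simp only [hper t]) (by
      rw [intervalIntegral.integral_sub (hc2.intervalIntegrable _ _) (by simp),
        intervalIntegral.integral_const, hκ, sub_zero, smul_eq_mul, mul_div_cancel₀ _ hpi.ne',
        sub_self])
  refine ⟨y a, Z, W, max B₁ B₂, κ, hc, hle a ha0, hZ0, hZ, fun t => (hZB t).trans (le_max_left _ _),
    ?_, hW, fun t => (hWB t).trans (le_max_right _ _)⟩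
  rw [hκ, div_le_iff₀ hpi]
  exact hn.le

/-- The oscillating factor is the exact derivative g(u/e) ∂u = ∂(e G(u/e)). Moving the derivative
onto y leaves a factor e. -/
theorem abs_integral_mul_oscillation_fderiv_le {d : ℕ} {g G : ℝ → ℝ} {B : ℝ} (hg : Continuous g)
    (hG : ∀ t, HasDerivAt G (g t) t) (hB : ∀ t, |G t| ≤ B) {u y : Rd d → ℝ}
    (hu : ContDiff ℝ 1 u) (hy : ContDiff ℝ 1 y) (hyc : HasCompactSupport y) (v : Rd d)
    {e : ℝ} (he : 0 < e) :
    |∫ x, y x * (g (u x / e) * fderiv ℝ u x v)| ≤ e * (B * ∫ x, |fderiv ℝ y x v|) := by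
  have hder : ∀ x, HasFDerivAt (fun x => e * G (u x / e)) (g (u x / e) • fderiv ℝ u x) x := by
    intro x
    have h1 : HasFDerivAt (fun x => u x / e) (e⁻¹ • fderiv ℝ u x) x := by
      simpa [div_eq_inv_mul] using
        (hu.contDiffAt.differentiableAt one_ne_zero).hasFDerivAt.const_mul e⁻¹
    have h2 := ((hG (u x / e)).comp_hasFDerivAt x h1).const_mul e
    convert! h2 using 1
    rw [smul_smul, smul_smul]
    congr 1
    field_simp
  have hfd : ∀ x, fderiv ℝ (fun x => e * G (u x / e)) x v = g (u x / e) * fderiv ℝ u x v := by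
    intro x; rw [(hder x).fderiv]; rfl
  have hGc : Continuous fun x => e * G (u x / e) :=
    continuous_iff_continuousAt.2 fun x => (hder x).continuousAt
  have c1 : Continuous fun x => g (u x / e) * fderiv ℝ u x v :=
    (hg.comp (hu.continuous.div_const e)).mul
      ((hu.continuous_fderiv one_ne_zero).clm_apply continuous_const)
  have c2 : Continuous fun x => fderiv ℝ y x v :=
    (hy.continuous_fderiv one_ne_zero).clm_apply continuous_const
  have hc2 : HasCompactSupport fun x => fderiv ℝ y x v := hyc.fderiv_apply (𝕜 := ℝ) v
  have := integral_mul_fderiv_eq_neg_fderiv_mul_of_integrable (μ := (volume : Measure (Rd d)))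
    (f := y) (g := fun x => e * G (u x / e)) (v := v)
    ((c2.mul hGc).integrable_of_hasCompactSupport hc2.mul_right)
    (by simp only [hfd]; exact (hy.continuous.mul c1).integrable_of_hasCompactSupport hyc.mul_right)
    ((hy.continuous.mul hGc).integrable_of_hasCompactSupport hyc.mul_right)
    (fun x _ => hy.contDiffAt.differentiableAt one_ne_zero)
    (fun x _ => (hder x).differentiableAt)
  simp only [hfd] at this
  rw [this, abs_neg, ← integral_const_mul, ← integral_const_mul]
  rw [← Real.norm_eq_abs]
  refine norm_integral_le_of_norm_le (((c2.abs.integrable_of_hasCompactSupport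
    (hc2.comp_left abs_zero)).const_mul B).const_mul e) (Eventually.of_forall fun x => ?_)
  rw [Real.norm_eq_abs, abs_mul, abs_mul, abs_of_pos he]
  nlinarith [mul_le_mul_of_nonneg_left (hB (u x / e))
    (mul_nonneg he.le (abs_nonneg (fderiv ℝ y x v)))]

/-- Used with a = ‖∇u‖: the quotient is a differentiable substitute for the norm, within δ
uniformly, even at critical points of u. -/
theorem sub_sq_div_sqrt_le {a δ : ℝ} (ha : 0 ≤ a) (hδ : 0 < δ) :
    |a - a ^ 2 / √(a ^ 2 + δ ^ 2)| ≤ δ := by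
  have hs : 0 < √(a ^ 2 + δ ^ 2) := Real.sqrt_pos.2 (by positivity)
  have h1 : a ≤ √(a ^ 2 + δ ^ 2) := Real.le_sqrt_of_sq_le (by nlinarith)
  have h2 : √(a ^ 2 + δ ^ 2) ≤ a + δ := Real.sqrt_le_left (by positivity) |>.2 (by nlinarith)
  have h3 : a - a ^ 2 / √(a ^ 2 + δ ^ 2) =
      a * (√(a ^ 2 + δ ^ 2) - a) / √(a ^ 2 + δ ^ 2) := by field_simp
  rw [h3, abs_of_nonneg (by have := sub_nonneg.2 h1; positivity), div_le_iff₀ hs]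
  nlinarith

/-- After replacing ‖∇u‖ by ‖∇u‖² / √(‖∇u‖² + δ²) = ∑ᵢ (∂ᵢu / √(‖∇u‖² + δ²)) ∂ᵢu, each summand is a
C¹ weight times g(u/e) ∂ᵢu, so integration by parts applies. -/
theorem tendsto_integral_oscillation_mul_norm_gradient {d : ℕ} {g G : ℝ → ℝ} {B C : ℝ}
    (hg : Continuous g) (hG : ∀ t, HasDerivAt G (g t) t) (hB : ∀ t, |G t| ≤ B)
    (hC : ∀ t, |g t| ≤ C) {u ψ : Rd d → ℝ} (hu : ContDiff ℝ 2 u) (hψ : ContDiff ℝ 1 ψ)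
    (hψc : HasCompactSupport ψ) :
    Tendsto (fun e : ℝ => ∫ x, ψ x * (g (u x / e) * ‖∇ u x‖)) (𝓝[>] 0) (𝓝 0) := by
  have hC0 : 0 ≤ C := (abs_nonneg _).trans (hC 0)
  have hu1 : ContDiff ℝ 1 u := hu.of_le (by norm_num)
  have hgr : ContDiff ℝ 1 (∇ u) :=
    (InnerProductSpace.toDual ℝ (Rd d)).symm.contDiff.comp (hu.fderiv_right (by norm_num))
  set E : Fin d → Rd d := fun i => EuclideanSpace.single i 1 with hE
  have hsum : ∀ x, ∑ i, fderiv ℝ u x (E i) * fderiv ℝ u x (E i) = ‖∇ u x‖ ^ 2 := by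
    intro x
    rw [EuclideanSpace.real_norm_sq_eq]
    refine Finset.sum_congr rfl fun i _ => ?_
    rw [← inner_gradient_left, hE, EuclideanSpace.inner_single_right]
    simp [sq]
  have hI : Integrable (fun x => |ψ x|) volume :=
    hψ.continuous.abs.integrable_of_hasCompactSupport (hψc.comp_left abs_zero)
  rw [Metric.tendsto_nhds]
  intro ε hε
  -- Chosen so that the regularisation error C δ ∫|ψ| is at most ε/2, uniformly in e.
  set δ : ℝ := ε / (2 * (C * (∫ x, |ψ x|) + 1)) with hδ
  have hM : 0 ≤ C * (∫ x, |ψ x|) := mul_nonneg hC0 (integral_nonneg fun _ => abs_nonneg _)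
  have hδ0 : 0 < δ := by positivity
  set s : Rd d → ℝ := fun x => √(‖∇ u x‖ ^ 2 + δ ^ 2) with hs
  have hs0 : ∀ x, s x ≠ 0 := fun x => (Real.sqrt_pos.2 (by positivity)).ne'
  have hsd : ContDiff ℝ 1 s :=
    ((hgr.norm_sq ℝ).add contDiff_const).sqrt fun x => by positivity
  -- These weights contain first derivatives of u, and they must be C¹; this is why u is assumed C².
  set y : Fin d → Rd d → ℝ := fun i x => ψ x * (fderiv ℝ u x (E i) / s x) with hy
  have hyd : ∀ i, ContDiff ℝ 1 (y i) := fun i =>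
    hψ.mul (((hu.fderiv_right (m := 1) (by norm_num)).clm_apply contDiff_const).div hsd hs0)
  have hyc : ∀ i, HasCompactSupport (y i) := fun i => hψc.mul_right
  have hlim : Tendsto (fun e : ℝ => ∑ i, e * (B * ∫ x, |fderiv ℝ (y i) x (E i)|)) (𝓝[>] 0)
      (𝓝 0) := by
    have : Tendsto (fun e : ℝ => ∑ i, e * (B * ∫ x, |fderiv ℝ (y i) x (E i)|)) (𝓝 0)
        (𝓝 (∑ i, 0 * (B * ∫ x, |fderiv ℝ (y i) x (E i)|))) :=
      tendsto_finsetSum _ fun i _ => tendsto_id.mul_const _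
    simpa using this.mono_left nhdsWithin_le_nhds
  filter_upwards [hlim.eventually (gt_mem_nhds (half_pos hε)), self_mem_nhdsWithin] with e he he0
  rw [mem_Ioi] at he0
  rw [Real.dist_eq, sub_zero]
  have hcg : Continuous fun x => g (u x / e) := hg.comp (hu.continuous.div_const e)
  have hcn : Continuous fun x => ‖∇ u x‖ := (continuous_gradient hu1).norm
  have ci : ∀ i, Integrable (fun x => y i x * (g (u x / e) * fderiv ℝ u x (E i))) volume := by
    intro i
    refine Continuous.integrable_of_hasCompactSupport ((hyd i).continuous.mul (hcg.mul ?_))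
      (hyc i).mul_right
    exact (hu1.continuous_fderiv one_ne_zero).clm_apply continuous_const
  have hsplit : ∫ x, ψ x * (g (u x / e) * ‖∇ u x‖) =
      (∑ i, ∫ x, y i x * (g (u x / e) * fderiv ℝ u x (E i))) +
      ∫ x, ψ x * (g (u x / e) * (‖∇ u x‖ - ‖∇ u x‖ ^ 2 / s x)) := by
    rw [← integral_finsetSum _ fun i _ => ci i, ← integral_add (integrable_finsetSum _ fun i _ => ci i)]
    · refine integral_congr_ae (Eventually.of_forall fun x => ?_)
      have : ∑ i, y i x * (g (u x / e) * fderiv ℝ u x (E i)) =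
          ψ x * g (u x / e) / s x * ‖∇ u x‖ ^ 2 := by
        rw [← hsum, Finset.mul_sum]
        refine Finset.sum_congr rfl fun i _ => ?_
        simp only [hy]; ring
      simp only [this]; ring
    · refine Continuous.integrable_of_hasCompactSupport ?_ hψc.mul_right
      exact hψ.continuous.mul (hcg.mul (hcn.sub ((hcn.pow 2).div hsd.continuous hs0)))
  rw [hsplit]
  have h1 : |∑ i, ∫ x, y i x * (g (u x / e) * fderiv ℝ u x (E i))| < ε / 2 := by
    refine ((Finset.abs_sum_le_sum_abs _ _).trans (Finset.sum_le_sum fun i _ => ?_)).trans_lt he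
    exact abs_integral_mul_oscillation_fderiv_le hg hG hB hu1 (hyd i) (hyc i) _ he0
  have h2 : |∫ x, ψ x * (g (u x / e) * (‖∇ u x‖ - ‖∇ u x‖ ^ 2 / s x))| ≤
      ∫ x, C * δ * |ψ x| := by
    rw [← Real.norm_eq_abs]
    refine norm_integral_le_of_norm_le (hI.const_mul _) (Eventually.of_forall fun x => ?_)
    rw [Real.norm_eq_abs, abs_mul, abs_mul, mul_comm]
    refine mul_le_mul_of_nonneg_right ?_ (abs_nonneg _)
    exact mul_le_mul (hC _) (sub_sq_div_sqrt_le (norm_nonneg _) hδ0) (abs_nonneg _) hC0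
  rw [integral_const_mul] at h2
  have h3 : C * δ * (∫ x, |ψ x|) ≤ ε / 2 := by
    have : C * δ * (∫ x, |ψ x|) = (C * (∫ x, |ψ x|)) / (C * (∫ x, |ψ x|) + 1) * (ε / 2) := by
      rw [hδ]; field_simp
    rw [this]
    refine mul_le_of_le_one_left (by positivity) ?_
    rw [div_le_one (by positivity)]; linarith
  exact (abs_add_le _ _).trans_lt (by linarith)

/-! ### Multiplying the gradient by oscillation. -/

/-- At z = 1 and z = -1 the left side vanishes, the latter because |1 - h| = h - 1 when h ≥ 1. In
between, the defect is controlled by the distance 1 - z² from these ideal values. -/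
theorem abs_abs_one_add_mul_sub_le {h z : ℝ} (hh : 1 ≤ h) (hz : |z| ≤ 1) :
    |(|1 + h * z| - h - z)| ≤ 2 * h * (1 - z ^ 2) := by
  obtain ⟨h1, h2⟩ := abs_le.1 hz
  rcases le_or_gt 0 (1 + h * z) with h3 | h3
  · rw [abs_of_nonneg h3, abs_le]
    rcases le_or_gt 0 z with h4 | h4
    · constructor <;> nlinarith [mul_nonneg h4 (sub_nonneg.2 h2), mul_nonneg (sub_nonneg.2 hh) (sub_nonneg.2 h2), mul_nonneg (mul_nonneg (sub_nonneg.2 hh) h4) (sub_nonneg.2 h2)]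
    · have : h - 1 ≤ 2 * h * (1 + z) := by nlinarith
      constructor <;> nlinarith [mul_le_mul_of_nonneg_right this (sub_nonneg.2 h2), mul_nonneg (sub_nonneg.2 hh) (sub_nonneg.2 h2)]
  · have h4 : z < 0 := by nlinarith
    have h5 : 0 ≤ 1 + z := by linarith
    have h6 : 0 ≤ h * (1 + z) := by positivity
    rw [abs_of_neg h3, abs_le]
    constructor <;> nlinarith [mul_nonneg h6 (neg_nonneg.2 h4.le),
      mul_nonneg (sub_nonneg.2 hh) h5]

/-- Superposing fine oscillations along the level sets of `u` multiplies `|∇u|` by `h ≥ 1` in the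
weak sense, while changing `u` little. -/
theorem exists_oscillation {d : ℕ} {u h : Rd d → ℝ} (hu : ContDiff ℝ 2 u)
    (huc : HasCompactSupport u) (hh : ContDiff ℝ 1 h) (hh1 : ∀ x, 1 ≤ h x)
    (F : Finset (Rd d → ℝ))
    (hF : ∀ ψ ∈ F, ContDiff ℝ 1 ψ ∧ HasCompactSupport ψ ∧ ∀ x, 0 ≤ ψ x) {ε : ℝ} (hε : 0 < ε) :
    ∃ v : Rd d → ℝ, ContDiff ℝ 1 v ∧ tsupport v ⊆ tsupport u ∧
      ∫ x, |v x - u x| ≤ ε ∧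
      ∀ ψ ∈ F, |(∫ x, ψ x * ‖∇ v x‖) - ∫ x, ψ x * h x * ‖∇ u x‖| ≤ ε := by
  have hu1 : ContDiff ℝ 1 u := hu.of_le (by norm_num)
  have hcu : Continuous fun x => ‖∇ u x‖ := (continuous_gradient hu1).norm
  have hch : Continuous fun x => ‖∇ h x‖ := (continuous_gradient hh).norm
  have hmass : ∀ ψ ∈ F, 0 ≤ ∫ x, ψ x * h x * ‖∇ u x‖ := fun ψ hψ => integral_nonneg fun x =>
    mul_nonneg (mul_nonneg ((hF ψ hψ).2.2 x) (zero_le_one.trans (hh1 x))) (norm_nonneg _)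
  set M : ℝ := ∑ ψ ∈ F, ∫ x, ψ x * h x * ‖∇ u x‖ with hM
  have hM0 : 0 ≤ M := Finset.sum_nonneg hmass
  -- M dominates the mass ∫ ψ h ‖∇u‖ of every ψ in F, so this η makes the non-vanishing error 2κ ∫ ψ
  -- h ‖∇u‖ at most ε/2.
  obtain ⟨z, Z, W, B, κ, hz, hz1, hZ0, hZ, hZB, hκ, hW, hWB⟩ :=
    exists_wave (η := ε / (4 * (M + 1))) (by positivity)
  have hB0 : 0 ≤ B := (abs_nonneg _).trans (hZB 0)
  -- The errors that vanish with e: the wave z, the centred wave 1 - z² - κ with weight ψ h, and the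
  -- contribution of ∇h.
  have hlim : ∀ ψ ∈ F, ∀ᶠ e in 𝓝[>] (0 : ℝ), |(∫ x, ψ x * (z (u x / e) * ‖∇ u x‖))| +
      2 * (∫ x, ψ x * h x * ((1 - z (u x / e) ^ 2 - κ) * ‖∇ u x‖)) +
      e * (B * ∫ x, ψ x * ‖∇ h x‖) < ε / 2 := by
    intro ψ hψ
    obtain ⟨h1, h2, h3⟩ := hF ψ hψ
    have l1 := (tendsto_integral_oscillation_mul_norm_gradient hz hZ hZB hz1 hu h1 h2).abs
    have hCW : ∀ t, |1 - z t ^ 2 - κ| ≤ 1 + |κ| := by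
      intro t
      have a1 := sq_le_one_iff_abs_le_one _ |>.2 (hz1 t)
      refine (abs_sub _ _).trans (add_le_add_left ?_ _)
      rw [abs_le]
      constructor <;> nlinarith [sq_nonneg (z t)]
    have l2 := (tendsto_integral_oscillation_mul_norm_gradient
      (g := fun t => 1 - z t ^ 2 - κ) (by fun_prop) hW hWB hCW hu (h1.mul hh) h2.mul_right).const_mul 2
    have l3 : Tendsto (fun e : ℝ => e * (B * ∫ x, ψ x * ‖∇ h x‖)) (𝓝[>] 0)
        (𝓝 (0 * (B * ∫ x, ψ x * ‖∇ h x‖))) :=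
      (tendsto_id.mul_const _).mono_left nhdsWithin_le_nhds
    have l4 := (l1.add l2).add l3
    simp only [abs_zero, mul_zero, zero_mul, add_zero] at l4
    exact l4.eventually (gt_mem_nhds (half_pos hε))
  have hlim0 : ∀ᶠ e in 𝓝[>] (0 : ℝ), e * (B * ∫ x in tsupport u, h x) < ε := by
    have l3 : Tendsto (fun e : ℝ => e * (B * ∫ x in tsupport u, h x)) (𝓝[>] 0)
        (𝓝 (0 * (B * ∫ x in tsupport u, h x))) :=
      (tendsto_id.mul_const _).mono_left nhdsWithin_le_nhds
    rw [zero_mul] at l3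
    exact l3.eventually (gt_mem_nhds hε)
  obtain ⟨e, hall, he1, he0⟩ := (((Filter.eventually_all_finset F).2 hlim).and
    (hlim0.and self_mem_nhdsWithin)).exists
  have hder : ∀ x, HasGradientAt (fun x => u x + e * h x * Z (u x / e))
      ((1 + h x * z (u x / e)) • ∇ u x + (e * Z (u x / e)) • ∇ h x) x := by
    intro x
    have a0 := (hu1.contDiffAt.differentiableAt one_ne_zero (x := x)).hasGradientAt.hasFDerivAt
    have a1 : HasFDerivAt (fun x => u x / e) (e⁻¹ • InnerProductSpace.toDual ℝ (Rd d) (∇ u x)) x := by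
      simpa [div_eq_inv_mul] using a0.const_mul e⁻¹
    have a2 := (hZ (u x / e)).comp_hasFDerivAt x a1
    have a3 := (hh.contDiffAt.differentiableAt one_ne_zero (x := x)).hasGradientAt.hasFDerivAt
    have a4 := a0.add ((a3.const_mul e).mul a2)
    rw [hasGradientAt_iff_hasFDerivAt]
    convert! a4 using 1
    simp only [map_add, map_smul, smul_smul, add_smul, one_smul, Function.comp]
    have : e * h x * (z (u x / e) * e⁻¹) = h x * z (u x / e) := by field_simp
    rw [this, mul_comm (Z _) e, add_assoc]
  have hgrad : ∀ x, ∇ (fun x => u x + e * h x * Z (u x / e)) x =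
      (1 + h x * z (u x / e)) • ∇ u x + (e * Z (u x / e)) • ∇ h x := fun x => (hder x).gradient
  have hZc : Continuous Z := continuous_iff_continuousAt.2 fun t => (hZ t).continuousAt
  have hZd : ContDiff ℝ 1 Z := by
    rw [contDiff_one_iff_deriv]
    refine ⟨fun t => (hZ t).differentiableAt, ?_⟩
    rwa [show deriv Z = z from funext fun t => (hZ t).deriv]
  have hcz : Continuous fun x => z (u x / e) := hz.comp (hu.continuous.div_const e)
  refine ⟨fun x => u x + e * h x * Z (u x / e), ?_, ?_, ?_, fun ψ hψ => ?_⟩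
  · exact hu1.add ((contDiff_const.mul hh).mul (hZd.comp (hu1.div_const e)))
  -- Since Z 0 = 0, the perturbation vanishes wherever u does.
  · refine closure_mono fun x hx => ?_
    contrapose! hx
    have : u x = 0 := by simpa using hx
    simp [this, hZ0]
  · simp only [add_sub_cancel_left]
    have hK : IsCompact (tsupport u) := huc
    refine le_trans ?_ he1.le
    rw [← setIntegral_eq_integral_of_forall_compl_eq_zero (s := tsupport u), ← integral_const_mul,
      ← integral_const_mul]
    · refine setIntegral_mono_on ?_ ?_ (isClosed_tsupport u).measurableSet fun x _ => ?_
      · refine Continuous.continuousOn ?_ |>.integrableOn_compact hK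
        exact ((continuous_const.mul hh.continuous).mul
          (hZc.comp (hu.continuous.div_const e))).abs
      · exact ((continuous_const.mul (continuous_const.mul hh.continuous)).continuousOn).integrableOn_compact hK
      · have hx0 : 0 ≤ h x := zero_le_one.trans (hh1 x)
        rw [abs_mul, abs_of_nonneg (by positivity), mul_assoc, mul_comm (h x)]
        gcongr
        exact hZB _
    · intro x hx
      simp [image_eq_zero_of_notMem_tsupport hx, hZ0]
  · obtain ⟨h1, h2, h3⟩ := hF ψ hψ
    have key := hall ψ hψ
    have ib : ∀ {q : Rd d → ℝ}, Continuous q → Integrable (fun x => ψ x * q x) volume := fun hq =>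
      (h1.continuous.mul hq).integrable_of_hasCompactSupport h2.mul_right
    have hcv : Continuous fun x => ‖(1 + h x * z (u x / e)) • ∇ u x + (e * Z (u x / e)) • ∇ h x‖ := by
      have c1 := continuous_gradient hu1
      have c2 := continuous_gradient hh
      have c3 : Continuous fun x => Z (u x / e) := hZc.comp (hu.continuous.div_const e)
      have c4 := hh.continuous
      fun_prop
    simp only [hgrad]
    have s1 : (∫ x, ψ x * ‖(1 + h x * z (u x / e)) • ∇ u x + (e * Z (u x / e)) • ∇ h x‖) -
        (∫ x, ψ x * h x * ‖∇ u x‖) - (∫ x, ψ x * (z (u x / e) * ‖∇ u x‖)) =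
        ∫ x, ψ x * (‖(1 + h x * z (u x / e)) • ∇ u x + (e * Z (u x / e)) • ∇ h x‖ -
          h x * ‖∇ u x‖ - z (u x / e) * ‖∇ u x‖) := by
      have j1 := ib hcv
      have j2 : Integrable (fun x => ψ x * (h x * ‖∇ u x‖)) volume := ib (hh.continuous.mul hcu)
      have j3 : Integrable (fun x => ψ x * (z (u x / e) * ‖∇ u x‖)) volume := ib (hcz.mul hcu)
      simp only [mul_assoc (ψ _) (h _)]
      rw [← integral_sub j1 j2, ← integral_sub (by exact j1.sub j2) j3]
      simp only [mul_sub]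
    -- The pointwise defect 2h(1 - z²)‖∇u‖ is split into its centred part and its mean 2κ h ‖∇u‖.
    have s2 : |∫ x, ψ x * (‖(1 + h x * z (u x / e)) • ∇ u x + (e * Z (u x / e)) • ∇ h x‖ -
          h x * ‖∇ u x‖ - z (u x / e) * ‖∇ u x‖)| ≤
        2 * (∫ x, ψ x * h x * ((1 - z (u x / e) ^ 2 - κ) * ‖∇ u x‖)) +
        2 * κ * (∫ x, ψ x * h x * ‖∇ u x‖) + e * (B * ∫ x, ψ x * ‖∇ h x‖) := by
      have c4 := hh.continuous
      have i1 : Integrable (fun x => 2 * (ψ x * h x * ((1 - z (u x / e) ^ 2 - κ) * ‖∇ u x‖)))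
          volume := by
        simp only [mul_assoc (ψ _) (h _)]
        exact (ib (by fun_prop)).const_mul 2
      have i2 : Integrable (fun x => 2 * κ * (ψ x * h x * ‖∇ u x‖)) volume := by
        simp only [mul_assoc (ψ _) (h _)]
        exact (ib (by fun_prop)).const_mul (2 * κ)
      have i3 : Integrable (fun x => e * (B * (ψ x * ‖∇ h x‖))) volume :=
        ((ib hch).const_mul B).const_mul e
      rw [← integral_const_mul, ← integral_const_mul, ← integral_const_mul, ← integral_const_mul,
        ← integral_add i1 i2, ← integral_add (by exact i1.add i2) i3, ← Real.norm_eq_abs]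
      refine norm_integral_le_of_norm_le ((i1.add i2).add i3) (Eventually.of_forall fun x => ?_)
      rw [Real.norm_eq_abs, abs_mul, abs_of_nonneg (h3 x)]
      have b1 : |‖(1 + h x * z (u x / e)) • ∇ u x + (e * Z (u x / e)) • ∇ h x‖ -
          |1 + h x * z (u x / e)| * ‖∇ u x‖| ≤ e * B * ‖∇ h x‖ := by
        have := abs_norm_sub_norm_le
          ((1 + h x * z (u x / e)) • ∇ u x + (e * Z (u x / e)) • ∇ h x)
          ((1 + h x * z (u x / e)) • ∇ u x)
        rw [add_sub_cancel_left, norm_smul, norm_smul, Real.norm_eq_abs, Real.norm_eq_abs,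
          abs_mul, abs_of_pos he0] at this
        refine this.trans ?_
        gcongr
        exact hZB _
      have b2 := mul_le_mul_of_nonneg_right (abs_abs_one_add_mul_sub_le (hh1 x) (hz1 (u x / e)))
        (norm_nonneg (∇ u x))
      rw [← abs_norm (∇ u x), ← abs_mul, abs_norm] at b2
      have b3 : |‖(1 + h x * z (u x / e)) • ∇ u x + (e * Z (u x / e)) • ∇ h x‖ -
          h x * ‖∇ u x‖ - z (u x / e) * ‖∇ u x‖| ≤ e * B * ‖∇ h x‖ +
          2 * h x * (1 - z (u x / e) ^ 2) * ‖∇ u x‖ := by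
        refine le_trans (le_of_eq ?_) ((abs_add_le _ _).trans (add_le_add b1 b2))
        congr 1; ring
      refine (mul_le_mul_of_nonneg_left b3 (h3 x)).trans (le_of_eq ?_)
      ring
    have s3 : 2 * κ * (∫ x, ψ x * h x * ‖∇ u x‖) ≤ ε / 2 := by
      have hle : (∫ x, ψ x * h x * ‖∇ u x‖) ≤ M :=
        Finset.single_le_sum (f := fun ψ : Rd d → ℝ => ∫ x, ψ x * h x * ‖∇ u x‖) hmass hψ
      have c1 : κ * (∫ x, ψ x * h x * ‖∇ u x‖) ≤ ε / (4 * (M + 1)) * (M + 1) :=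
        mul_le_mul hκ (by linarith) (hmass ψ hψ) (by positivity)
      have c2 : ε / (4 * (M + 1)) * (M + 1) = ε / 4 := by field_simp
      linarith
    have s4 := abs_add_le ((∫ x, ψ x * ‖(1 + h x * z (u x / e)) • ∇ u x + (e * Z (u x / e)) • ∇ h x‖) -
        (∫ x, ψ x * h x * ‖∇ u x‖) - (∫ x, ψ x * (z (u x / e) * ‖∇ u x‖)))
        (∫ x, ψ x * (z (u x / e) * ‖∇ u x‖))
    rw [sub_add_cancel, s1] at s4
    linarith

/-! ### Cutoffs and mollification. -/

open scoped Convolution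
open scoped Manifold in
/-- Smooth cutoff functions. -/
theorem exists_cutoff {d : ℕ} {K U : Set (Rd d)} (hK : IsCompact K) (hU : IsOpen U)
    (hKU : K ⊆ U) :
    ∃ χ : Rd d → ℝ, ContDiff ℝ ∞ χ ∧ HasCompactSupport χ ∧ tsupport χ ⊆ U ∧
      (∀ x, χ x ∈ Icc (0 : ℝ) 1) ∧ ∀ᶠ x in 𝓝ˢ K, χ x = 1 := by
  obtain ⟨L, hL, hKL, hLU⟩ := exists_compact_between hK hU hKU
  obtain ⟨f, h1, h0, h⟩ := exists_contMDiffMap_one_nhds_of_subset_interior (n := ⊤) 𝓘(ℝ, Rd d)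
    hK.isClosed hKL
  have hs : tsupport f ⊆ L :=
    closure_minimal (fun x hx => by_contra fun hxL => hx (h0 x hxL)) hL.isClosed
  exact ⟨f, f.contMDiff.contDiff, hL.of_isClosed_subset (isClosed_tsupport _) hs, hs.trans hLU, h, h1⟩

/-- A sequence of bump functions concentrating at the origin. -/
noncomputable def bumpSeq (d n : ℕ) : ContDiffBump (0 : Rd d) where
  rIn := 1 / ((n : ℝ) + 2)
  rOut := 1 / ((n : ℝ) + 1)
  rIn_pos := by positivity
  rIn_lt_rOut := by gcongr; norm_num

/-- The standard mollifiers on `ℝ^d`. -/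
noncomputable def mollifier (d n : ℕ) : Rd d → ℝ := (bumpSeq d n).normed volume

theorem tendsto_bumpSeq_rOut (d : ℕ) : Tendsto (fun n => (bumpSeq d n).rOut) atTop (𝓝 0) :=
  tendsto_one_div_add_atTop_nhds_zero_nat

theorem bumpSeq_rOut_le_one (d n : ℕ) : (bumpSeq d n).rOut ≤ 1 := by
  change 1 / ((n : ℝ) + 1) ≤ 1
  rw [div_le_one (by positivity)]
  linarith [(Nat.cast_nonneg n : (0 : ℝ) ≤ n)]

theorem mollifier_contDiff (d n : ℕ) : ContDiff ℝ ∞ (mollifier d n) :=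
  (bumpSeq d n).contDiff_normed

theorem mollifier_continuous (d n : ℕ) : Continuous (mollifier d n) :=
  (bumpSeq d n).continuous_normed

theorem mollifier_nonneg {d n : ℕ} (x : Rd d) : 0 ≤ mollifier d n x :=
  (bumpSeq d n).nonneg_normed x

theorem mollifier_hasCompactSupport (d n : ℕ) : HasCompactSupport (mollifier d n) :=
  (bumpSeq d n).hasCompactSupport_normed

theorem mollifier_sub_comm {d n : ℕ} (x y : Rd d) : mollifier d n (x - y) = mollifier d n (y - x) := by
  rw [← neg_sub]; exact (bumpSeq d n).normed_neg _

theorem exists_mollifier_le (d n : ℕ) : ∃ C, ∀ x, ‖mollifier d n x‖ ≤ C :=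
  (mollifier_hasCompactSupport d n).exists_bound_of_continuous (mollifier_continuous d n)

theorem lintegral_enorm_mollifier (d n : ℕ) : ∫⁻ x, ‖mollifier d n x‖ₑ = 1 := by
  have h : Integrable (mollifier d n) volume := (bumpSeq d n).integrable_normed
  have h2 : ∫ x, mollifier d n x = 1 := (bumpSeq d n).integral_normed
  simp_rw [Real.enorm_eq_ofReal (mollifier_nonneg _)]
  rw [← ofReal_integral_eq_lintegral_ofReal h (Eventually.of_forall mollifier_nonneg), h2,
    ENNReal.ofReal_one]

theorem convolutionExists_mollifier {d n : ℕ} {E : Type*} [NormedAddCommGroup E] [NormedSpace ℝ E]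
    {g : Rd d → E} (hg : LocallyIntegrable g volume) :
    ConvolutionExists (mollifier d n) g (ContinuousLinearMap.lsmul ℝ ℝ) volume :=
  (mollifier_hasCompactSupport d n).convolutionExists_left _ (mollifier_continuous d n) hg

/-- Tonelli, translation invariance and unit mass of the kernel. -/
theorem lintegral_enorm_mollify_le {d n : ℕ} {g : Rd d → ℝ} (hg : Integrable g volume) :
    ∫⁻ x, ‖(mollifier d n ⋆[ContinuousLinearMap.lsmul ℝ ℝ, volume] g) x‖ₑ ≤ ∫⁻ x, ‖g x‖ₑ := by
  calc ∫⁻ x, ‖(mollifier d n ⋆[ContinuousLinearMap.lsmul ℝ ℝ, volume] g) x‖ₑ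
      ≤ ∫⁻ x, ∫⁻ t, ‖(ContinuousLinearMap.lsmul ℝ ℝ : ℝ →L[ℝ] ℝ →L[ℝ] ℝ)
          (mollifier d n t) (g (x - t))‖ₑ :=
        lintegral_mono fun x => enorm_integral_le_lintegral_enorm _
    _ = ∫⁻ t, ∫⁻ x, ‖(ContinuousLinearMap.lsmul ℝ ℝ : ℝ →L[ℝ] ℝ →L[ℝ] ℝ)
          (mollifier d n t) (g (x - t))‖ₑ := by
        refine lintegral_lintegral_swap ?_
        exact (AEStronglyMeasurable.convolution_integrand _
          (mollifier_continuous d n).aestronglyMeasurable hg.aestronglyMeasurable).enorm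
    _ = ∫⁻ t, ‖mollifier d n t‖ₑ * ∫⁻ x, ‖g x‖ₑ := by
        refine lintegral_congr fun t => ?_
        simp only [ContinuousLinearMap.lsmul_apply, enorm_smul]
        rw [lintegral_const_mul' _ _ enorm_ne_top,
          lintegral_sub_right_eq_self (fun x => ‖g x‖ₑ) t]
    _ = ∫⁻ x, ‖g x‖ₑ := by
        rw [lintegral_mul_const' _ _ hg.2.ne, lintegral_enorm_mollifier, one_mul]

theorem eventually_norm_mollify_sub_le {d : ℕ} {E : Type*} [NormedAddCommGroup E] [NormedSpace ℝ E]
    [CompleteSpace E] {Y : Rd d → E} (hY : Continuous Y) (hc : HasCompactSupport Y) {ε : ℝ}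
    (hε : 0 < ε) : ∀ᶠ n in atTop, ∀ x,
      ‖(mollifier d n ⋆[ContinuousLinearMap.lsmul ℝ ℝ, volume] Y) x - Y x‖ ≤ ε := by
  obtain ⟨δ, hδ, h⟩ := Metric.uniformContinuous_iff.1 (hc.uniformContinuous_of_continuous hY) ε hε
  filter_upwards [(tendsto_bumpSeq_rOut d).eventually (gt_mem_nhds hδ)] with n hn x
  rw [← dist_eq_norm]
  exact ContDiffBump.dist_normed_convolution_le hY.aestronglyMeasurable fun y hy =>
    (h ((Metric.mem_ball.1 hy).trans hn)).le

/-- All kernels have radius at most 1, so the exceptional set does not depend on n. Uniform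
convergence then yields L¹ convergence. -/
theorem mollify_eq_of_eq_zero {d n : ℕ} {Y : Rd d → ℝ} (hY : Continuous Y) {x : Rd d}
    (hx : x ∉ Metric.cthickening 1 (tsupport Y)) :
    (mollifier d n ⋆[ContinuousLinearMap.lsmul ℝ ℝ, volume] Y) x - Y x = 0 := by
  rw [← norm_le_zero_iff, ← dist_eq_norm]
  have h0 : ∀ y ∈ Metric.ball x 1, Y y = 0 := by
    intro y hy
    refine image_eq_zero_of_notMem_tsupport fun h => hx ?_
    exact Metric.mem_cthickening_of_dist_le x y 1 _ h (by rw [dist_comm]; exact (Metric.mem_ball.1 hy).le)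
  refine ContDiffBump.dist_normed_convolution_le hY.aestronglyMeasurable fun y hy => ?_
  rw [h0 y (Metric.ball_subset_ball (bumpSeq_rOut_le_one d n) hy), h0 x (Metric.mem_ball_self one_pos),
    dist_self]

/-- Approximate g in L¹ by a continuous c of compact support. Mollification is an L¹ contraction, so
only c matters, and for c uniform convergence on a fixed compact set suffices. -/
theorem tendsto_lintegral_mollify_sub {d : ℕ} {g : Rd d → ℝ} (hg : Integrable g volume) :
    Tendsto (fun n => ∫⁻ x, ‖(mollifier d n ⋆[ContinuousLinearMap.lsmul ℝ ℝ, volume] g) x - g x‖ₑ)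
      atTop (𝓝 0) := by
  rw [ENNReal.tendsto_nhds_zero]
  intro ε hε
  obtain ⟨η, hη, hηε⟩ : ∃ η : ℝ≥0∞, η ≠ 0 ∧ η + η + η ≤ ε :=
    ⟨ε / 3, by simpa using hε.ne', (ENNReal.add_thirds ε).le⟩
  obtain ⟨c, hcc, hcε, hc, hci⟩ := hg.exists_hasCompactSupport_lintegral_sub_le hη
  set K := Metric.cthickening 1 (tsupport c) with hK
  have hKc : IsCompact K := IsCompact.cthickening hcc
  obtain ⟨b, hb0, hb⟩ : ∃ b : ℝ, 0 < b ∧ ENNReal.ofReal b * volume K ≤ η := by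
    obtain ⟨b, hb, hb'⟩ := ENNReal.exists_nnreal_pos_mul_lt (hKc.measure_lt_top (μ := volume)).ne hη
    exact ⟨b, by exact_mod_cast hb, by rw [ENNReal.ofReal_coe_nnreal]; exact hb'.le⟩
  filter_upwards [eventually_norm_mollify_sub_le hc hcc hb0] with n hn
  have hgc : Integrable (g - c) volume := hg.sub hci
  have hsplit : ∀ x, (mollifier d n ⋆[ContinuousLinearMap.lsmul ℝ ℝ, volume] g) x - g x =
      (mollifier d n ⋆[ContinuousLinearMap.lsmul ℝ ℝ, volume] (g - c)) x - (g - c) x +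
      ((mollifier d n ⋆[ContinuousLinearMap.lsmul ℝ ℝ, volume] c) x - c x) := by
    intro x
    have := (convolutionExists_mollifier (n := n) hgc.locallyIntegrable x).distrib_add
      (convolutionExists_mollifier hci.locallyIntegrable x)
    rw [sub_add_cancel] at this
    rw [this, Pi.sub_apply]; ring
  have h1 : ∫⁻ x, ‖(mollifier d n ⋆[ContinuousLinearMap.lsmul ℝ ℝ, volume] c) x - c x‖ₑ ≤ η := by
    refine le_trans ?_ hb
    rw [← lintegral_indicator_const hKc.measurableSet]
    refine lintegral_mono fun x => ?_
    by_cases hx : x ∈ K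
    · rw [indicator_of_mem hx, ← ofReal_norm]
      exact ENNReal.ofReal_le_ofReal (hn x)
    · rw [mollify_eq_of_eq_zero hc hx]; simp
  have hm : AEMeasurable (fun x => ‖(g - c) x‖ₑ) volume := hgc.aestronglyMeasurable.enorm
  calc ∫⁻ x, ‖(mollifier d n ⋆[ContinuousLinearMap.lsmul ℝ ℝ, volume] g) x - g x‖ₑ
      ≤ ∫⁻ x, ((‖(mollifier d n ⋆[ContinuousLinearMap.lsmul ℝ ℝ, volume] (g - c)) x‖ₑ +
          ‖(g - c) x‖ₑ) +
          ‖(mollifier d n ⋆[ContinuousLinearMap.lsmul ℝ ℝ, volume] c) x - c x‖ₑ) := by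
        refine lintegral_mono fun x => ?_
        rw [hsplit]
        exact (enorm_add_le _ _).trans (add_le_add_left enorm_sub_le _)
    _ ≤ (η + η) + η := by
        have hm2 : AEMeasurable (fun x =>
            ‖(mollifier d n ⋆[ContinuousLinearMap.lsmul ℝ ℝ, volume] (g - c)) x‖ₑ) volume :=
          ((mollifier_hasCompactSupport d n).continuous_convolution_left _
            (mollifier_continuous d n) hgc.locallyIntegrable).enorm.aemeasurable
        rw [lintegral_add_left' (by exact hm2.add hm), lintegral_add_left' hm2]
        refine add_le_add (add_le_add ((lintegral_enorm_mollify_le hgc).trans hcε) hcε) h1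
    _ ≤ ε := hηε

theorem continuous_integral_mollifier_smul {d n : ℕ} {E : Type*} [NormedAddCommGroup E]
    [NormedSpace ℝ E] {μ : Measure (Rd d)} {σ : Rd d → E} (hσ : Integrable σ μ) :
    Continuous fun x => ∫ y, mollifier d n (x - y) • σ y ∂μ := by
  obtain ⟨C, hC⟩ := exists_mollifier_le d n
  refine continuous_of_dominated (bound := fun y => C * ‖σ y‖) (fun x => ?_) (fun x => ?_)
    (hσ.norm.const_mul C) ?_
  · exact ((mollifier_continuous d n).comp
      (continuous_const.sub continuous_id)).aestronglyMeasurable.smul hσ.aestronglyMeasurable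
  · refine Eventually.of_forall fun y => ?_
    rw [norm_smul]
    exact mul_le_mul_of_nonneg_right (hC _) (norm_nonneg _)
  · exact Eventually.of_forall fun y =>
      ((mollifier_continuous d n).comp (continuous_id.sub continuous_const)).smul continuous_const

/-- Fubini together with the evenness of the kernel: mollification is self-adjoint. -/
theorem integral_inner_mollify_comm {d n : ℕ} {E : Type*} [NormedAddCommGroup E]
    [InnerProductSpace ℝ E] [CompleteSpace E] {μ : Measure (Rd d)} [IsFiniteMeasure μ]
    {σ : Rd d → E} (hσ : Integrable σ μ) {Y : Rd d → E} (hY : Continuous Y)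
    (hc : HasCompactSupport Y) :
    ∫ x, inner ℝ (Y x) (∫ y, mollifier d n (x - y) • σ y ∂μ) =
      ∫ y, inner ℝ ((mollifier d n ⋆[ContinuousLinearMap.lsmul ℝ ℝ, volume] Y) y) (σ y) ∂μ := by
  obtain ⟨C, hC⟩ := exists_mollifier_le d n
  have hYi : Integrable Y volume := hY.integrable_of_hasCompactSupport hc
  have hint : ∀ x, Integrable (fun y => mollifier d n (x - y) • σ y) μ := fun x =>
    hσ.bdd_smul C ((mollifier_continuous d n).comp
      (continuous_const.sub continuous_id)).aestronglyMeasurable (Eventually.of_forall fun y => hC _)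
  have hprod : Integrable (Function.uncurry fun x y =>
      inner ℝ (Y x) (mollifier d n (x - y) • σ y)) ((volume : Measure (Rd d)).prod μ) := by
    refine ((hYi.norm.mul_prod hσ.norm).const_mul C).mono' ?_ (Eventually.of_forall fun p => ?_)
    · refine AEStronglyMeasurable.inner hYi.aestronglyMeasurable.comp_fst ?_
      exact ((mollifier_continuous d n).comp
        (continuous_fst.sub continuous_snd)).aestronglyMeasurable.smul
        hσ.aestronglyMeasurable.comp_snd
    · refine (norm_inner_le_norm _ _).trans ?_
      rw [norm_smul]
      calc ‖Y p.1‖ * (‖mollifier d n (p.1 - p.2)‖ * ‖σ p.2‖)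
          ≤ ‖Y p.1‖ * (C * ‖σ p.2‖) := by gcongr; exact hC _
        _ = C * (‖Y p.1‖ * ‖σ p.2‖) := by ring
  calc ∫ x, inner ℝ (Y x) (∫ y, mollifier d n (x - y) • σ y ∂μ)
      = ∫ x, ∫ y, inner ℝ (Y x) (mollifier d n (x - y) • σ y) ∂μ :=
        integral_congr_ae (Eventually.of_forall fun x => (integral_inner (hint x) _).symm)
    _ = ∫ y, (∫ x, inner ℝ (Y x) (mollifier d n (x - y) • σ y)) ∂μ := integral_integral_swap hprod
    _ = _ := by
        refine integral_congr_ae (Eventually.of_forall fun y => ?_)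
        have hi : Integrable (fun x => mollifier d n (y - x) • Y x) volume :=
          hYi.bdd_smul C ((mollifier_continuous d n).comp
            (continuous_const.sub continuous_id)).aestronglyMeasurable
            (Eventually.of_forall fun y => hC _)
        simp only [convolution_eq_swap, ContinuousLinearMap.lsmul_apply]
        rw [real_inner_comm, ← integral_inner hi]
        refine integral_congr_ae (Eventually.of_forall fun x => ?_)
        simp only [real_inner_smul_right]
        rw [mollifier_sub_comm, real_inner_comm]

theorem tendsto_integral_inner_mollify {d : ℕ} {E : Type*} [NormedAddCommGroup E]
    [InnerProductSpace ℝ E] [CompleteSpace E] {μ : Measure (Rd d)} [IsFiniteMeasure μ]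
    {σ : Rd d → E} (hσ : Integrable σ μ) {Y : Rd d → E} (hY : Continuous Y)
    (hc : HasCompactSupport Y) :
    Tendsto (fun n => ∫ x, inner ℝ (Y x) (∫ y, mollifier d n (x - y) • σ y ∂μ)) atTop
      (𝓝 (∫ y, inner ℝ (Y y) (σ y) ∂μ)) := by
  simp only [integral_inner_mollify_comm hσ hY hc]
  have hYi : Integrable Y volume := hY.integrable_of_hasCompactSupport hc
  have hI : 0 ≤ ∫ y, ‖σ y‖ ∂μ := integral_nonneg fun _ => norm_nonneg _
  rw [Metric.tendsto_nhds]
  intro ε hε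
  filter_upwards [eventually_norm_mollify_sub_le hY hc
    (show 0 < ε / ((∫ y, ‖σ y‖ ∂μ) + 1) by positivity)] with n hn
  have hb : ∀ {X : Rd d → E}, Continuous X → HasCompactSupport X →
      Integrable (fun y => inner ℝ (X y) (σ y)) μ := by
    intro X hX hXc
    obtain ⟨C, hC⟩ := hXc.exists_bound_of_continuous hX
    refine (hσ.norm.const_mul C).mono' (hX.aestronglyMeasurable.inner hσ.aestronglyMeasurable)
      (Eventually.of_forall fun y => (norm_inner_le_norm _ _).trans ?_)
    exact mul_le_mul_of_nonneg_right (hC y) (norm_nonneg _)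
  have hcc : Continuous (mollifier d n ⋆[ContinuousLinearMap.lsmul ℝ ℝ, volume] Y) :=
    (mollifier_hasCompactSupport d n).continuous_convolution_left _ (mollifier_continuous d n)
      hYi.locallyIntegrable
  have hcs : HasCompactSupport (mollifier d n ⋆[ContinuousLinearMap.lsmul ℝ ℝ, volume] Y) :=
    (mollifier_hasCompactSupport d n).convolution _ hc
  rw [Real.dist_eq, ← integral_sub (hb hcc hcs) (hb hY hc)]
  refine lt_of_le_of_lt (b := ε / ((∫ y, ‖σ y‖ ∂μ) + 1) * ∫ y, ‖σ y‖ ∂μ) ?_ ?_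
  · rw [← integral_const_mul, ← Real.norm_eq_abs]
    refine norm_integral_le_of_norm_le (hσ.norm.const_mul _) (Eventually.of_forall fun y => ?_)
    rw [← inner_sub_left]
    exact (norm_inner_le_norm _ _).trans (mul_le_mul_of_nonneg_right (hn y) (norm_nonneg _))
  · rw [div_mul_eq_mul_div, div_lt_iff₀ (by positivity)]
    nlinarith

/-! ### Vague convergence of total variations under mollification. -/

/-- Take a continuous approximation of σ and retract it radially onto the unit ball. As ‖σ‖ = 1, the
retraction moves X by at most ‖σ - X‖, so the error at most doubles. -/
theorem exists_unit_approx {d : ℕ} {μ : Measure (Rd d)} [IsFiniteMeasure μ] {σ : Rd d → Rd d}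
    (hσ : Integrable σ μ) (h1 : ∀ᵐ x ∂μ, ‖σ x‖ = 1) {δ : ℝ} (hδ : 0 < δ) :
    ∃ X : Rd d → Rd d, Continuous X ∧ (∀ x, ‖X x‖ ≤ 1) ∧ Integrable X μ ∧
      ∫ x, ‖σ x - X x‖ ∂μ ≤ δ := by
  obtain ⟨X, hXc, hXδ, hX, hXi⟩ := hσ.exists_hasCompactSupport_integral_sub_le (half_pos hδ)
  have hpos : ∀ x, 0 < max 1 ‖X x‖ := fun x => lt_max_of_lt_left one_pos
  have hc : Continuous fun x => (max 1 ‖X x‖)⁻¹ • X x :=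
    ((continuous_const.max hX.norm).inv₀ fun x => (hpos x).ne').smul hX
  have hle : ∀ x, ‖(max 1 ‖X x‖)⁻¹ • X x‖ ≤ 1 := by
    intro x
    rw [norm_smul, norm_inv, Real.norm_of_nonneg (hpos x).le, inv_mul_le_one₀ (hpos x)]
    exact le_max_right _ _
  have hi : Integrable (fun x => (max 1 ‖X x‖)⁻¹ • X x) μ :=
    (integrable_const (1 : ℝ)).mono' hc.aestronglyMeasurable (Eventually.of_forall hle)
  refine ⟨_, hc, hle, hi, ?_⟩
  calc ∫ x, ‖σ x - (max 1 ‖X x‖)⁻¹ • X x‖ ∂μ ≤ ∫ x, 2 * ‖σ x - X x‖ ∂μ := by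
        refine integral_mono_ae (hσ.sub hi).norm ((hσ.sub hXi).norm.const_mul 2) ?_
        filter_upwards [h1] with x hx
        have e1 : ‖X x - (max 1 ‖X x‖)⁻¹ • X x‖ ≤ ‖σ x - X x‖ := by
          have : X x - (max 1 ‖X x‖)⁻¹ • X x = (1 - (max 1 ‖X x‖)⁻¹) • X x := by
            rw [sub_smul, one_smul]
          rw [this, norm_smul]
          rcases le_total ‖X x‖ 1 with h | h
          · rw [max_eq_left h]; simp
          · rw [max_eq_right h, Real.norm_of_nonneg (sub_nonneg.2 (inv_le_one_of_one_le₀ h)),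
              sub_mul, inv_mul_cancel₀ (by positivity), one_mul, norm_sub_rev, ← hx]
            exact norm_sub_norm_le _ _
        have e2 := norm_add_le (σ x - X x) (X x - (max 1 ‖X x‖)⁻¹ • X x)
        rw [sub_add_sub_cancel] at e2
        linarith
    _ ≤ δ := by rw [integral_const_mul]; linarith

/-- The total variations of the mollifications of a vector measure converge vaguely. -/
theorem tendsto_integral_mul_norm_mollify {d : ℕ} {μ : Measure (Rd d)} [IsFiniteMeasure μ]
    {σ : Rd d → Rd d} (hσ : Integrable σ μ) (h1 : ∀ᵐ x ∂μ, ‖σ x‖ = 1) {ψ : Rd d → ℝ}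
    (hψ : Continuous ψ) (hc : HasCompactSupport ψ) (h0 : ∀ x, 0 ≤ ψ x) :
    Tendsto (fun n => ∫ x, ψ x * ‖∫ y, mollifier d n (x - y) • σ y ∂μ‖) atTop
      (𝓝 (∫ x, ψ x ∂μ)) := by
  have hwc : ∀ n, Continuous fun x => ∫ y, mollifier d n (x - y) • σ y ∂μ := fun n =>
    continuous_integral_mollifier_smul hσ
  have hwi : ∀ n, Integrable (fun x => ψ x * ‖∫ y, mollifier d n (x - y) • σ y ∂μ‖) volume :=
    fun n => (hψ.mul (hwc n).norm).integrable_of_hasCompactSupport hc.mul_right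
  have hψi : Integrable ψ μ := hψ.integrable_of_hasCompactSupport hc
  -- Upper bound: since ‖σ‖ = 1, the mollification of σ μ has norm at most that of μ, to which the
  -- scalar case applies.
  have hup := tendsto_integral_inner_mollify (σ := fun _ : Rd d => (1 : ℝ))
    (integrable_const (μ := μ) (1 : ℝ)) hψ hc
  simp only [RCLike.inner_apply, conj_trivial, smul_eq_mul, mul_one, one_mul] at hup
  obtain ⟨M, hM⟩ := hc.exists_bound_of_continuous hψ
  have hM0 : 0 ≤ M := (norm_nonneg _).trans (hM 0)
  rw [Metric.tendsto_nhds]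
  intro ε hε
  obtain ⟨X, hX, hX1, hXi, hXδ⟩ := exists_unit_approx hσ h1
    (show 0 < ε / (2 * (M + 1)) by positivity)
  have hYc : HasCompactSupport fun x => ψ x • X x := hc.smul_right
  -- Lower bound: pair with ψ X, where ‖X‖ ≤ 1 and X is close to σ in L¹(μ).
  have hlow := tendsto_integral_inner_mollify hσ (Y := fun x => ψ x • X x) (hψ.smul hX) hYc
  have hle : (∫ x, ψ x ∂μ) - ε / 2 ≤ ∫ y, inner ℝ (ψ y • X y) (σ y) ∂μ := by
    have hi : Integrable (fun y => inner ℝ (ψ y • X y) (σ y)) μ := by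
      refine (hσ.norm.const_mul M).mono' ((hψ.smul hX).aestronglyMeasurable.inner
        hσ.aestronglyMeasurable) (Eventually.of_forall fun y => (norm_inner_le_norm _ _).trans ?_)
      rw [norm_smul]
      refine mul_le_mul_of_nonneg_right ?_ (norm_nonneg _)
      exact (mul_le_mul (hM y) (hX1 y) (norm_nonneg _) hM0).trans (mul_one M).le
    have : (∫ x, ψ x ∂μ) - ∫ y, inner ℝ (ψ y • X y) (σ y) ∂μ ≤ ∫ y, M * ‖σ y - X y‖ ∂μ := by
      rw [← integral_sub hψi hi]
      refine integral_mono_ae (hψi.sub hi) ((hσ.sub hXi).norm.const_mul M) ?_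
      filter_upwards [h1] with y hy
      have e1 : ψ y - inner ℝ (ψ y • X y) (σ y) = ψ y * inner ℝ (σ y - X y) (σ y) := by
        rw [inner_sub_left, real_inner_self_eq_norm_sq, hy, real_inner_smul_left]; ring
      have e2 := real_inner_le_norm (σ y - X y) (σ y)
      rw [hy, mul_one] at e2
      have e3 := (le_abs_self _).trans (hM y)
      simp only [e1]
      exact (mul_le_mul_of_nonneg_left e2 (h0 y)).trans
        (mul_le_mul_of_nonneg_right e3 (norm_nonneg _))
    rw [integral_const_mul] at this
    have h2 : M * ∫ y, ‖σ y - X y‖ ∂μ ≤ ε / 2 := by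
      calc M * ∫ y, ‖σ y - X y‖ ∂μ ≤ (M + 1) * (ε / (2 * (M + 1))) := by
            refine mul_le_mul (by linarith) hXδ (integral_nonneg fun _ => norm_nonneg _) (by linarith)
        _ = ε / 2 := by field_simp
    linarith
  filter_upwards [hup.eventually (gt_mem_nhds (lt_add_of_pos_right _ hε)),
    hlow.eventually (lt_mem_nhds (sub_lt_self _ (half_pos hε)))] with n hn1 hn2
  rw [Real.dist_eq, abs_sub_lt_iff]
  constructor
  · have : ∫ x, ψ x * ‖∫ y, mollifier d n (x - y) • σ y ∂μ‖ ≤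
        ∫ x, (∫ y, mollifier d n (x - y) ∂μ) * ψ x := by
      have hcm : Continuous fun x => ∫ y, mollifier d n (x - y) ∂μ := by
        simpa using continuous_integral_mollifier_smul (n := n) (integrable_const (μ := μ) (1 : ℝ))
      refine integral_mono (hwi n) ((hcm.mul hψ).integrable_of_hasCompactSupport hc.mul_left)
        fun x => ?_
      simp only
      rw [mul_comm]
      refine mul_le_mul_of_nonneg_right ((norm_integral_le_integral_norm _).trans (le_of_eq ?_)) (h0 x)
      refine integral_congr_ae ?_
      filter_upwards [h1] with y hy
      rw [norm_smul, hy, mul_one, Real.norm_of_nonneg (mollifier_nonneg _)]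
    linarith
  · have : ∫ x, inner ℝ (ψ x • X x) (∫ y, mollifier d n (x - y) • σ y ∂μ) ≤
        ∫ x, ψ x * ‖∫ y, mollifier d n (x - y) • σ y ∂μ‖ := by
      refine integral_mono ?_ (hwi n) fun x => ?_
      · refine ((hψ.smul hX).inner (hwc n)).integrable_of_hasCompactSupport ?_
        exact hYc.mono fun x hx h => hx (by simp only [] at h ⊢; rw [h, inner_zero_left])
      · simp only
        rw [real_inner_smul_left]
        refine mul_le_mul_of_nonneg_left ((real_inner_le_norm _ _).trans ?_) (h0 x)
        exact mul_le_of_le_one_left (norm_nonneg _) (hX1 x)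
    linarith

/-! ### Smooth approximation of φ and of the density f. -/

/-- Put the derivative on the kernel. The translated kernel is an admissible test function because
its support stays in Ω, so the definition of Dφ applies. -/
theorem gradient_mollify {d n : ℕ} {Ω : Set (Rd d)} (hΩ : IsOpen Ω) {φ : Rd d → ℝ}
    (hφ : IntegrableOn φ Ω volume) {D : VectorMeasure (Rd d) (Rd d)} (hD : HasGradMeasure Ω φ D)
    {σ : Rd d → Rd d} (hσ : Integrable σ D.variation) (hDσ : D.variation.withDensityᵥ σ = D)
    {x : Rd d} (hx : Metric.closedBall x (bumpSeq d n).rOut ⊆ Ω) :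
    ∇ (mollifier d n ⋆[ContinuousLinearMap.lsmul ℝ ℝ, volume] Ω.indicator φ) x =
      ∫ y, mollifier d n (x - y) • σ y ∂D.variation := by
  have hfin := isFiniteMeasure_variation D
  have hg : Integrable (Ω.indicator φ) volume := (integrable_indicator_iff hΩ.measurableSet).2 hφ
  have hρ1 : ContDiff ℝ 1 (mollifier d n) := (mollifier_contDiff d n).of_le (by simp)
  have hρc := mollifier_hasCompactSupport d n
  set ψ : Rd d → ℝ := fun y => mollifier d n (x - y) with hψ
  have hψd : ContDiff ℝ ∞ ψ := (mollifier_contDiff d n).comp (contDiff_const.sub contDiff_id)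
  have hψs : tsupport ψ ⊆ Metric.closedBall x (bumpSeq d n).rOut := by
    refine closure_minimal (fun y hy => ?_) Metric.isClosed_closedBall
    have : x - y ∈ Function.support (mollifier d n) := hy
    rw [mollifier, ContDiffBump.support_normed_eq, mem_ball_zero_iff] at this
    rw [Metric.mem_closedBall, dist_eq_norm, norm_sub_rev]
    exact this.le
  have hψc : HasCompactSupport ψ :=
    (isCompact_closedBall _ _).of_isClosed_subset (isClosed_tsupport _) hψs
  have hψi : Integrable ψ D.variation := hψd.continuous.integrable_of_hasCompactSupport hψc
  have hfd : ∀ y e, fderiv ℝ ψ y e = -fderiv ℝ (mollifier d n) (x - y) e := by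
    intro y e
    have h1 : HasFDerivAt (fun y : Rd d => x - y) (-ContinuousLinearMap.id ℝ (Rd d)) y := by
      simpa using (hasFDerivAt_id (𝕜 := ℝ) y).const_sub x
    have h2 := (hρ1.contDiffAt.differentiableAt one_ne_zero (x := x - y)).hasFDerivAt.comp y h1
    rw [show ψ = mollifier d n ∘ fun y => x - y from rfl, h2.fderiv]
    simp
  have e1 : ∫ᵛ y, ψ y ∂•D = ∫ y, ψ y • σ y ∂D.variation := by
    have := integral_withDensityᵥ_eq_integral_smul hσ (ψ := ψ) (by rwa [hDσ])
    rwa [hDσ] at this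
  have e2 := hD.integral_eq ψ hψd hψc (hψs.trans hx)
  rw [e1] at e2
  rw [← neg_eq_iff_eq_neg.2 e2]
  refine ext_inner_left ℝ fun e => ?_
  have hi : IntegrableOn (fun y => φ y • ∇ ψ y) Ω volume := by
    have hc := continuous_gradient (hψd.of_le (m := 1) (by simp))
    obtain ⟨C, hC⟩ := (hasCompactSupport_gradient hψc).exists_bound_of_continuous hc
    refine (hφ.norm.const_mul C).mono' (hφ.aestronglyMeasurable.smul hc.aestronglyMeasurable)
      (Eventually.of_forall fun y => ?_)
    rw [norm_smul, mul_comm]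
    exact mul_le_mul_of_nonneg_right (hC y) (norm_nonneg _)
  have hex : ConvolutionExistsAt (fderiv ℝ (mollifier d n)) (Ω.indicator φ) x
      ((ContinuousLinearMap.lsmul ℝ ℝ : ℝ →L[ℝ] ℝ →L[ℝ] ℝ).precompL (Rd d)) volume :=
    (hρc.fderiv ℝ).convolutionExists_left _ (hρ1.continuous_fderiv one_ne_zero)
      hg.locallyIntegrable x
  rw [real_inner_comm, inner_gradient_left, (hρc.hasFDerivAt_convolution_left
    (ContinuousLinearMap.lsmul ℝ ℝ) hρ1 hg.locallyIntegrable x).fderiv, convolution_eq_swap,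
    ContinuousLinearMap.integral_apply hex.integrable_swap, inner_neg_right, ← integral_inner hi,
    ← integral_neg, ← integral_indicator hΩ.measurableSet]
  refine integral_congr_ae (Eventually.of_forall fun y => ?_)
  by_cases hy : y ∈ Ω
  · simp only [ContinuousLinearMap.precompL_apply, ContinuousLinearMap.lsmul_apply,
      indicator_of_mem hy, real_inner_smul_right]
    rw [real_inner_comm, inner_gradient_left, hfd, smul_eq_mul]
    ring
  · simp [indicator_of_notMem hy]

/-- Local smooth approximation of a `BV` function, with vague convergence of the total
variations. -/
theorem exists_smooth_approx {d : ℕ} {Ω : Set (Rd d)} (hΩ : IsOpen Ω) {φ : Rd d → ℝ}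
    (hφ : IntegrableOn φ Ω volume) {D : VectorMeasure (Rd d) (Rd d)} (hD : HasGradMeasure Ω φ D)
    {K : Set (Rd d)} (hK : IsCompact K) (hKΩ : K ⊆ Ω) {ε : ℝ≥0∞} (hε : ε ≠ 0) :
    ∃ u : ℕ → Rd d → ℝ,
      (∀ n, ContDiff ℝ ∞ (u n) ∧ HasCompactSupport (u n) ∧ tsupport (u n) ⊆ Ω) ∧
      (∀ᶠ n in atTop, ∫⁻ x in Ω, ‖u n x - φ x‖ₑ ≤ ε) ∧
      ∀ ψ : Rd d → ℝ, Continuous ψ → tsupport ψ ⊆ K → (∀ x, 0 ≤ ψ x) →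
        Tendsto (fun n => ∫ x, ψ x * ‖∇ (u n) x‖) atTop (𝓝 (∫ x, ψ x ∂D.variation)) := by
  have hfin := isFiniteMeasure_variation D
  obtain ⟨σ, hσ, hDσ, hσ1⟩ := exists_density_variation D
  have hg : Integrable (Ω.indicator φ) volume := (integrable_indicator_iff hΩ.measurableSet).2 hφ
  have hfin2 : IsFiniteMeasure (volume.withDensity fun x => ‖Ω.indicator φ x‖ₑ) :=
    ⟨by rw [withDensity_apply _ MeasurableSet.univ, Measure.restrict_univ]; exact hg.2⟩
  -- K' carries all but ε/2 of the L¹ mass of φ. The cutoff equals 1 on K' to protect the L¹ error,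
  -- and near K to leave gradients there unchanged.
  obtain ⟨K', hK'Ω, hK', hK'ε⟩ := hΩ.measurableSet.exists_isCompact_sdiff_lt
    (μ := volume.withDensity fun x => ‖Ω.indicator φ x‖ₑ) (measure_ne_top _ _)
    (ENNReal.half_pos hε).ne'
  obtain ⟨χ, hχ, hχc, hχs, hχ01, hχ1⟩ := exists_cutoff (hK.union hK') hΩ (union_subset hKΩ hK'Ω)
  set m : ℕ → Rd d → ℝ := fun n =>
    mollifier d n ⋆[ContinuousLinearMap.lsmul ℝ ℝ, volume] Ω.indicator φ with hm
  have hmd : ∀ n, ContDiff ℝ ∞ (m n) := fun n =>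
    (mollifier_hasCompactSupport d n).contDiff_convolution_left _ (mollifier_contDiff d n)
      hg.locallyIntegrable
  refine ⟨fun n x => χ x * m n x, fun n => ⟨hχ.mul (hmd n), hχc.mul_right, ?_⟩, ?_, ?_⟩
  · exact (tsupport_mul_subset_left).trans hχs
  · filter_upwards [(tendsto_lintegral_mollify_sub hg).eventually
      (ge_mem_nhds (ENNReal.half_pos hε))] with n hn
    have hms : MeasurableSet (Ω \ K') := hΩ.measurableSet.diff hK'.measurableSet
    calc ∫⁻ x in Ω, ‖χ x * m n x - φ x‖ₑ
        ≤ ∫⁻ x in Ω, (‖m n x - Ω.indicator φ x‖ₑ +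
            (Ω \ K').indicator (fun x => ‖Ω.indicator φ x‖ₑ) x) := by
          refine setLIntegral_mono' hΩ.measurableSet fun x hx => ?_
          have h1 : χ x * m n x - φ x =
              χ x * (m n x - Ω.indicator φ x) + (χ x - 1) * Ω.indicator φ x := by
            rw [indicator_of_mem hx]; ring
          rw [h1]
          refine (enorm_add_le _ _).trans (add_le_add ?_ ?_)
          · rw [enorm_mul]
            refine mul_le_of_le_one_left zero_le ?_
            rw [← enorm_one (G := ℝ), enorm_le_iff_norm_le, Real.norm_of_nonneg (hχ01 x).1]
            simpa using (hχ01 x).2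
          · by_cases hxK : x ∈ K'
            · have : χ x = 1 := hχ1.self_of_nhdsSet x (Or.inr hxK)
              simp [this]
            · rw [indicator_of_mem (show x ∈ Ω \ K' from ⟨hx, hxK⟩), enorm_mul]
              refine mul_le_of_le_one_left zero_le ?_
              rw [← enorm_one (G := ℝ), enorm_le_iff_norm_le, Real.norm_eq_abs, norm_one, abs_le]
              constructor <;> linarith [(hχ01 x).1, (hχ01 x).2]
      _ ≤ ε / 2 + ε / 2 := by
          rw [lintegral_add_right' _ (hg.aestronglyMeasurable.enorm.indicator hms).restrict]
          refine add_le_add ((setLIntegral_le_lintegral _ _).trans hn) ?_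
          refine (setLIntegral_le_lintegral _ _).trans ?_
          rw [lintegral_indicator hms, ← withDensity_apply _ hms]
          exact hK'ε.le
      _ = ε := ENNReal.add_halves ε
  · intro ψ hψ hψs hψ0
    have hψc : HasCompactSupport ψ := hK.of_isClosed_subset (isClosed_tsupport _) hψs
    obtain ⟨δ, hδ, hδΩ⟩ := hK.exists_cthickening_subset_open hΩ hKΩ
    refine (tendsto_integral_mul_norm_mollify hσ hσ1 hψ hψc hψ0).congr' ?_
    filter_upwards [(tendsto_bumpSeq_rOut d).eventually (gt_mem_nhds hδ)] with n hn
    refine integral_congr_ae (Eventually.of_forall fun x => ?_)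
    by_cases hx : x ∈ K
    · have h1 : (fun x => χ x * m n x) =ᶠ[𝓝 x] m n := by
        have := (eventually_nhdsSet_iff_forall.1 hχ1) x (Or.inl hx)
        filter_upwards [this] with y hy
        rw [hy, one_mul]
      simp only
      rw [h1.gradient_eq, hm, gradient_mollify hΩ hφ hD hσ hDσ]
      refine (Metric.closedBall_subset_closedBall hn.le).trans (subset_trans ?_ hδΩ)
      exact Metric.closedBall_subset_cthickening hx δ
    · simp [image_eq_zero_of_notMem_tsupport fun h => hx (hψs h)]

/-- An integrable function bounded below by `1` is approximated in `L¹` by smooth ones. -/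
theorem exists_smooth_one_le_approx {d : ℕ} {μ : Measure (Rd d)} [IsFiniteMeasure μ] {f : Rd d → ℝ}
    (hf : Integrable f μ) (hf1 : ∀ᵐ x ∂μ, 1 ≤ f x) {ε : ℝ} (hε : 0 < ε) :
    ∃ h : Rd d → ℝ, ContDiff ℝ 1 h ∧ (∀ x, 1 ≤ h x) ∧ Integrable h μ ∧
      ∫ x, |h x - f x| ∂μ ≤ ε := by
  have hg : Integrable (fun x => f x - 1) μ := hf.sub (integrable_const 1)
  obtain ⟨c, hcc, hcε, hc, hci⟩ := hg.exists_hasCompactSupport_integral_sub_le (half_pos hε)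
  -- The smooth g stays within δ of the positive part of c. Adding δ makes g + δ ≥ 0, hence h ≥ 1,
  -- and the total cost 2δ μ(univ) is at most ε/2.
  set δ : ℝ := ε / (4 * (μ.real univ + 1)) with hδ
  have hμ : 0 ≤ μ.real univ := measureReal_nonneg
  have hδ0 : 0 < δ := by positivity
  obtain ⟨g, hgd, hgc, -⟩ := (hc.max (continuous_const (y := (0 : ℝ)))).exists_contDiff_approx 1
    (ε := fun _ => δ) continuous_const fun _ => hδ0
  have hgc' : ∀ x, |g x - max (c x) 0| ≤ δ := fun x => (hgc x).le
  have hgi : Integrable g μ := by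
    refine ((hci.norm).add (integrable_const δ)).mono' hgd.continuous.aestronglyMeasurable
      (Eventually.of_forall fun x => ?_)
    have h1 := abs_le.1 (hgc' x)
    have h2 : |max (c x) 0| ≤ |c x| := by
      rw [abs_of_nonneg (le_max_right _ _)]
      exact max_le (le_abs_self _) (abs_nonneg _)
    rw [abs_of_nonneg (le_max_right _ _)] at h2
    simp only [Pi.add_apply, Real.norm_eq_abs]
    rw [abs_le]
    constructor <;> linarith [le_max_right (c x) 0]
  refine ⟨fun x => 1 + (g x + δ), contDiff_const.add (hgd.add contDiff_const), fun x => ?_,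
    (integrable_const 1).add (hgi.add (integrable_const δ)), ?_⟩
  · have := (abs_le.1 (hgc' x)).1
    linarith [le_max_right (c x) 0]
  · calc ∫ x, |1 + (g x + δ) - f x| ∂μ ≤ ∫ x, (‖f x - 1 - c x‖ + 2 * δ) ∂μ := by
          refine integral_mono_ae (((integrable_const 1).add
            (hgi.add (integrable_const δ))).sub hf).abs
            ((hg.sub hci).norm.add (integrable_const (2 * δ))) ?_
          filter_upwards [hf1] with x hx
          have h1 := abs_le.1 (hgc' x)
          have h2 := abs_le.1 (le_refl |f x - 1 - c x|)
          rw [Real.norm_eq_abs]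
          rw [abs_le]
          rcases le_total (c x) 0 with h3 | h3
          · rw [max_eq_right h3] at h1
            constructor <;> linarith
          · rw [max_eq_left h3] at h1
            constructor <;> linarith
      _ = (∫ x, ‖f x - 1 - c x‖ ∂μ) + μ.real univ * (2 * δ) := by
          rw [integral_add (by exact (hg.sub hci).norm) (integrable_const _), integral_const,
            smul_eq_mul]
      _ ≤ ε / 2 + ε / 2 := by
          refine add_le_add hcε ?_
          have : μ.real univ * (2 * δ) = μ.real univ / (μ.real univ + 1) * (ε / 2) := by
            rw [hδ]; field_simp; ring
          rw [this]
          refine mul_le_of_le_one_left (by positivity) ?_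
          rw [div_le_one (by positivity)]
          linarith
      _ = ε := add_halves ε

/-- Smooth compactly supported test functions on `Ω` with values in `[0, 1]`. -/
structure IsTest {d : ℕ} (Ω : Set (Rd d)) (ψ : Rd d → ℝ) : Prop where
  contDiff : ContDiff ℝ ∞ ψ
  hasCompactSupport : HasCompactSupport ψ
  tsupport_subset : tsupport ψ ⊆ Ω
  mem_Icc : ∀ x, ψ x ∈ Icc (0 : ℝ) 1

/-- Three errors of size ε/3 against each test function: f is replaced by h, then |Dφ| by ‖∇u‖
tested against ψ h, and finally h ‖∇u‖ by ‖∇v‖. The order matters, as the choice of u depends on h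
and that of v on both. -/
theorem exists_approx_of_finset {d : ℕ} {Ω : Set (Rd d)} (hΩ : IsOpen Ω) {φ : Rd d → ℝ}
    (hφ : MemBV Ω φ) {f : Rd d → ℝ} (hf : Integrable f (totalVar Ω φ))
    (hf1 : ∀ᵐ x ∂(totalVar Ω φ), 1 ≤ f x) (F : Finset (Rd d → ℝ)) (hF : ∀ ψ ∈ F, IsTest Ω ψ)
    {ε : ℝ} (hε : 0 < ε) :
    ∃ v : Rd d → ℝ, ContDiff ℝ 1 v ∧ HasCompactSupport v ∧ tsupport v ⊆ Ω ∧
      ∫⁻ x in Ω, ‖v x - φ x‖ₑ ≤ ENNReal.ofReal ε ∧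
      ∀ ψ ∈ F, |(∫ x, ψ x * ‖∇ v x‖) - ∫ x, ψ x * f x ∂(totalVar Ω φ)| ≤ ε := by
  have hfin : IsFiniteMeasure (totalVar Ω φ) := isFiniteMeasure_variation _
  obtain ⟨D, hD⟩ := hφ.2
  have hvar : totalVar Ω φ = D.variation := by rw [totalVar, hD.gradMeasure_eq hΩ]
  have hε3 : 0 < ε / 3 := by positivity
  obtain ⟨h, hh, hh1, hhi, hhf⟩ := exists_smooth_one_le_approx hf hf1 hε3
  have hK : IsCompact (⋃ ψ ∈ F, tsupport ψ) :=
    F.isCompact_biUnion fun ψ hψ => (hF ψ hψ).hasCompactSupport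
  obtain ⟨u, hu, huφ, hutest⟩ := exists_smooth_approx hΩ hφ.1 hD hK
    (iUnion₂_subset fun ψ hψ => (hF ψ hψ).tsupport_subset)
    (ε := ENNReal.ofReal (ε / 3)) (by simpa using hε3)
  rw [← hvar] at hutest
  have hev : ∀ ψ ∈ F, ∀ᶠ n in atTop,
      |(∫ x, ψ x * h x * ‖∇ (u n) x‖) - ∫ x, ψ x * h x ∂(totalVar Ω φ)| < ε / 3 := by
    intro ψ hψ
    have := hutest (fun x => ψ x * h x) ((hF ψ hψ).contDiff.continuous.mul hh.continuous)
      (tsupport_mul_subset_left.trans (subset_biUnion_of_mem (u := fun ψ : Rd d → ℝ => tsupport ψ) hψ))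
      (fun x => mul_nonneg ((hF ψ hψ).mem_Icc x).1 (zero_le_one.trans (hh1 x)))
    exact this.eventually (Metric.ball_mem_nhds _ hε3)
  obtain ⟨n, hn1, hn2⟩ := (((Filter.eventually_all_finset F).2 hev).and huφ).exists
  obtain ⟨hun, hunc, huns⟩ := hu n
  obtain ⟨v, hv, hvs, hvu, hvtest⟩ := exists_oscillation (contDiff_infty.1 hun 2) hunc hh hh1 F
    (fun ψ hψ => ⟨(hF ψ hψ).contDiff.of_le (by simp), (hF ψ hψ).hasCompactSupport,
      fun x => ((hF ψ hψ).mem_Icc x).1⟩) hε3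
  have hvc : HasCompactSupport v := hunc.mono' ((subset_tsupport v).trans hvs)
  refine ⟨v, hv, hvc, hvs.trans huns, ?_, fun ψ hψ => ?_⟩
  · have hi : Integrable (fun x => v x - u n x) volume :=
      (hv.continuous.integrable_of_hasCompactSupport hvc).sub
        (hun.continuous.integrable_of_hasCompactSupport hunc)
    calc ∫⁻ x in Ω, ‖v x - φ x‖ₑ ≤ ∫⁻ x in Ω, (‖v x - u n x‖ₑ + ‖u n x - φ x‖ₑ) := by
          refine lintegral_mono fun x => ?_
          rw [← sub_add_sub_cancel (v x) (u n x) (φ x)]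
          exact enorm_add_le _ _
      _ ≤ ENNReal.ofReal (ε / 3) + ENNReal.ofReal (ε / 3) := by
          rw [lintegral_add_left' hi.aestronglyMeasurable.enorm.restrict]
          refine add_le_add ((setLIntegral_le_lintegral _ _).trans ?_) hn2
          rw [← ofReal_integral_norm_eq_lintegral_enorm hi]
          exact ENNReal.ofReal_le_ofReal hvu
      _ ≤ ENNReal.ofReal ε := by
          rw [← ENNReal.ofReal_add hε3.le hε3.le]
          exact ENNReal.ofReal_le_ofReal (by linarith)
  · have hb : ∀ {g : Rd d → ℝ}, Integrable g (totalVar Ω φ) →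
        Integrable (fun x => ψ x * g x) (totalVar Ω φ) := fun hg =>
      hg.bdd_mul (c := 1) (hF ψ hψ).contDiff.continuous.aestronglyMeasurable
        (Eventually.of_forall fun x => by
          rw [Real.norm_of_nonneg ((hF ψ hψ).mem_Icc x).1]; exact ((hF ψ hψ).mem_Icc x).2)
    have h3 : |(∫ x, ψ x * h x ∂(totalVar Ω φ)) - ∫ x, ψ x * f x ∂(totalVar Ω φ)| ≤ ε / 3 := by
      rw [← integral_sub (hb hhi) (hb hf), ← Real.norm_eq_abs]
      refine (norm_integral_le_of_norm_le (hhi.sub hf).abs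
        (Eventually.of_forall fun x => ?_)).trans hhf
      rw [← mul_sub, Real.norm_eq_abs, abs_mul, abs_of_nonneg ((hF ψ hψ).mem_Icc x).1]
      exact mul_le_of_le_one_left (abs_nonneg _) ((hF ψ hψ).mem_Icc x).2
    have h1 := abs_le.1 (hvtest ψ hψ)
    have h2 := abs_lt.1 (hn1 ψ hψ)
    have h3 := abs_le.1 h3
    rw [abs_le]
    constructor <;> linarith [h1.1, h1.2, h2.1, h2.2, h3.1, h3.2]

/-! ### A countable test family and the portmanteau argument. -/

theorem exists_finset_basis_cover {X : Type*} [TopologicalSpace X] {B : Set (Set X)}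
    (hB : TopologicalSpace.IsTopologicalBasis B) {K U : Set X} (hK : IsCompact K) (hU : IsOpen U) (hKU : K ⊆ U) :
    ∃ s : Finset B, K ⊆ ⋃ b ∈ s, (b : Set X) ∧ ⋃ b ∈ s, (b : Set X) ⊆ U := by
  classical
  refine hK.induction_on (p := fun K => ∃ s : Finset B, K ⊆ ⋃ b ∈ s, (b : Set X) ∧
    ⋃ b ∈ s, (b : Set X) ⊆ U) ⟨∅, by simp⟩ ?_ ?_ ?_
  · rintro s t hst ⟨r, hr, hrU⟩
    exact ⟨r, hst.trans hr, hrU⟩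
  · rintro s t ⟨r, hr, hrU⟩ ⟨q, hq, hqU⟩
    refine ⟨r ∪ q, ?_, ?_⟩
    · rw [Finset.set_biUnion_union]
      exact union_subset_union hr hq
    · rw [Finset.set_biUnion_union]
      exact union_subset hrU hqU
  · intro x hx
    obtain ⟨b, hbB, hxb, hbU⟩ := hB.exists_subset_of_mem_open (hKU hx) hU
    exact ⟨b, mem_nhdsWithin_of_mem_nhds (hB.mem_nhds hbB hxb), {⟨b, hbB⟩}, by simp, by simpa⟩

/-- A countable family of test functions separating compact sets from complements of open sets. -/
theorem exists_countable_test_family {d : ℕ} (Ω : Set (Rd d)) :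
    ∃ ψ : ℕ → Rd d → ℝ, (∀ j, IsTest Ω (ψ j)) ∧
      ∀ K U : Set (Rd d), IsCompact K → IsOpen U → K ⊆ U → U ⊆ Ω →
        ∃ j, (∀ x ∈ K, ψ j x = 1) ∧ ∀ x ∉ U, ψ j x = 0 := by
  classical
  set B := TopologicalSpace.countableBasis (Rd d)
  have hB := TopologicalSpace.isBasis_countableBasis (Rd d)
  have : Countable B := (TopologicalSpace.countable_countableBasis (Rd d)).to_subtype
  -- Countability comes from indexing by pairs of finite subfamilies of a countable basis; pairs
  -- admitting no cutoff receive 0.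
  let Q : Finset B × Finset B → (Rd d → ℝ) → Prop := fun i ψ =>
    IsTest Ω ψ ∧ (∀ x ∈ ⋃ b ∈ i.1, (b : Set (Rd d)), ψ x = 1) ∧
      ∀ x ∉ ⋃ b ∈ i.2, (b : Set (Rd d)), ψ x = 0
  have h0 : IsTest Ω (0 : Rd d → ℝ) :=
    ⟨contDiff_const, HasCompactSupport.zero, by simp [tsupport], by simp⟩
  let Ψ : Finset B × Finset B → Rd d → ℝ := fun i => if h : ∃ ψ, Q i ψ then h.choose else 0
  have hΨ : ∀ i, IsTest Ω (Ψ i) := by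
    intro i
    by_cases h : ∃ ψ, Q i ψ
    · simp only [Ψ, dif_pos h]; exact h.choose_spec.1
    · simp only [Ψ, dif_neg h]; exact h0
  obtain ⟨e, he⟩ := exists_surjective_nat (Finset B × Finset B)
  refine ⟨fun j => Ψ (e j), fun j => hΨ _, fun K U hK hU hKU hUΩ => ?_⟩
  -- The first union is squeezed between K and L, the second between L and U. A cutoff for L shows
  -- that this pair is admissible, and any function chosen for it separates K from the complement of
  -- U.
  obtain ⟨L, hL, hKL, hLU⟩ := exists_compact_between hK hU hKU
  obtain ⟨s, hs, hsL⟩ := exists_finset_basis_cover hB hK isOpen_interior hKL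
  obtain ⟨t, ht, htU⟩ := exists_finset_basis_cover hB hL hU hLU
  have hto : IsOpen (⋃ b ∈ t, (b : Set (Rd d))) :=
    isOpen_biUnion fun b _ => hB.isOpen b.2
  obtain ⟨χ, hχ, hχc, hχs, hχ01, hχ1⟩ := exists_cutoff hL hto ht
  have hex : ∃ ψ, Q (s, t) ψ := by
    refine ⟨χ, ⟨hχ, hχc, hχs.trans (htU.trans hUΩ), hχ01⟩, fun x hx => ?_, fun x hx => ?_⟩
    · exact hχ1.self_of_nhdsSet x (interior_subset (hsL hx))
    · exact image_eq_zero_of_notMem_tsupport fun h => hx (hχs h)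
  obtain ⟨j, hj⟩ := he (s, t)
  obtain ⟨-, q1, q2⟩ := hex.choose_spec
  refine ⟨j, ?_⟩
  simp only [hj, Ψ, dif_pos hex]
  exact ⟨fun x hx => q1 x (hs hx), fun x hx => q2 x fun h => hx (htU h)⟩

/-- A local portmanteau theorem. -/
theorem tendsto_measure_of_tendsto_lintegral_test {d : ℕ} {Ω : Set (Rd d)} (hΩ : IsOpen Ω)
    {ψ : ℕ → Rd d → ℝ} (hψ : ∀ j, IsTest Ω (ψ j))
    (hsep : ∀ K U : Set (Rd d), IsCompact K → IsOpen U → K ⊆ U → U ⊆ Ω →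
        ∃ j, (∀ x ∈ K, ψ j x = 1) ∧ ∀ x ∉ U, ψ j x = 0)
    {m : ℕ → Measure (Rd d)} {ν : Measure (Rd d)} [IsFiniteMeasure ν]
    (hconv : ∀ j, Tendsto (fun k => ∫⁻ x, ENNReal.ofReal (ψ j x) ∂(m k)) atTop
      (𝓝 (∫⁻ x, ENNReal.ofReal (ψ j x) ∂ν)))
    {E : Set (Rd d)} (hE : IsCompact (closure E)) (hEΩ : closure E ⊆ Ω)
    (hfr : ν (frontier E) = 0) : Tendsto (fun k => m k E) atTop (𝓝 (ν E)) := by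
  have hlow : ∀ {μ : Measure (Rd d)} {j : ℕ} {K : Set (Rd d)}, MeasurableSet K →
      (∀ x ∈ K, ψ j x = 1) → μ K ≤ ∫⁻ x, ENNReal.ofReal (ψ j x) ∂μ := by
    intro μ j K hK h1
    rw [← lintegral_indicator_one hK]
    refine lintegral_mono fun x => ?_
    by_cases hx : x ∈ K
    · simp [hx, h1 x hx]
    · simp [hx]
  have hupp : ∀ {μ : Measure (Rd d)} {j : ℕ} {U : Set (Rd d)}, MeasurableSet U →
      (∀ x ∉ U, ψ j x = 0) → ∫⁻ x, ENNReal.ofReal (ψ j x) ∂μ ≤ μ U := by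
    intro μ j U hU h0
    rw [← lintegral_indicator_one hU]
    refine lintegral_mono fun x => ?_
    by_cases hx : x ∈ U
    · simpa [hx] using ((hψ j).mem_Icc x).2
    · simp [hx, h0 x hx]
  have hcl : ν (closure E) = ν E := by
    refine le_antisymm ?_ (measure_mono subset_closure)
    rw [closure_eq_self_union_frontier]
    exact (measure_union_le _ _).trans (by rw [hfr, add_zero])
  have hin : ν (interior E) = ν E := by
    refine le_antisymm (measure_mono interior_subset) ?_
    rw [← self_sdiff_frontier]
    exact (measure_sdiff_null hfr).ge
  refine tendsto_order.2 ⟨fun a ha => ?_, fun a ha => ?_⟩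
  -- Lower bound: inner regularity of ν on the interior of E.
  · rw [← hin] at ha
    obtain ⟨K, hKE, hK, haK⟩ := isOpen_interior.exists_lt_isCompact ha
    obtain ⟨j, h1, h0⟩ := hsep K (interior E) hK isOpen_interior hKE
      (interior_subset.trans (subset_closure.trans hEΩ))
    filter_upwards [(hconv j).eventually
      (lt_mem_nhds (haK.trans_le (hlow hK.measurableSet h1)))] with k hk
    exact hk.trans_le ((hupp isOpen_interior.measurableSet h0).trans (measure_mono interior_subset))
  -- Upper bound: outer regularity of ν at the closure of E, with the open set cut down to Ω.
  · rw [← hcl] at ha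
    obtain ⟨U, hEU, hU, hUa⟩ := (closure E).exists_isOpen_lt_of_lt _ ha
    obtain ⟨j, h1, h0⟩ := hsep (closure E) (U ∩ Ω) hE (hU.inter hΩ) (subset_inter hEU hEΩ)
      inter_subset_right
    have hj : ∫⁻ x, ENNReal.ofReal (ψ j x) ∂ν < a :=
      ((hupp (hU.inter hΩ).measurableSet h0).trans (measure_mono inter_subset_left)).trans_lt hUa
    filter_upwards [(hconv j).eventually (gt_mem_nhds hj)] with k hk
    exact (measure_mono subset_closure).trans_lt
      ((hlow isClosed_closure.measurableSet h1).trans_lt hk)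

/-! ### The diagonal sequence. -/

theorem mainTheorem5 {d : ℕ} (Ω : Set (Rd d)) (hΩ : IsOpen Ω) (hΩb : Bornology.IsBounded Ω)
    (φ : Rd d → ℝ) (hφ : MemBV Ω φ)
    (f : Rd d → ℝ) (hf : Integrable f (totalVar Ω φ)) (hf1 : ∀ᵐ x ∂(totalVar Ω φ), 1 ≤ f x) :
    ∃ φk : ℕ → Rd d → ℝ,
      (∀ k, MemBV Ω (φk k)) ∧
      Tendsto (fun k => ∫⁻ x in Ω, ‖φk k x - φ x‖ₑ) atTop (𝓝 0) ∧
      ∀ E : Set (Rd d), MeasurableSet E → IsCompact (closure E) → closure E ⊆ Ω →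
        totalVar Ω φ (frontier E) = 0 →
        Tendsto (fun k => totalVar Ω (φk k) E) atTop
          (𝓝 (ENNReal.ofReal (∫ x in E, f x ∂(totalVar Ω φ)))) := by
  classical
  have hfin : IsFiniteMeasure (totalVar Ω φ) := isFiniteMeasure_variation _
  obtain ⟨ψ, hψ, hsep⟩ := exists_countable_test_family Ω
  have hpos : ∀ k : ℕ, (0 : ℝ) < 1 / ((k : ℝ) + 1) := fun k => Nat.one_div_pos_of_nat
  -- The k-th function is correct up to 1/(k+1) against the first k test functions, so each fixed ψ
  -- j is controlled once k > j.
  choose v hv hvc hvs hvφ hvtest using fun k : ℕ => exists_approx_of_finset hΩ hφ hf hf1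
    ((Finset.range k).image ψ) (fun q hq => by
      obtain ⟨j, -, rfl⟩ := Finset.mem_image.1 hq; exact hψ j) (hpos k)
  have hf0 : 0 ≤ᵐ[totalVar Ω φ] f := hf1.mono fun x hx => zero_le_one.trans hx
  have hfm : AEMeasurable (fun x => ENNReal.ofReal (f x)) (totalVar Ω φ) :=
    hf.aestronglyMeasurable.aemeasurable.ennreal_ofReal
  have hν : IsFiniteMeasure ((totalVar Ω φ).withDensity fun x => ENNReal.ofReal (f x)) := by
    refine ⟨?_⟩
    rw [withDensity_apply _ MeasurableSet.univ, Measure.restrict_univ,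
      ← ofReal_integral_eq_lintegral_ofReal hf hf0]
    exact ENNReal.ofReal_lt_top
  refine ⟨v, fun k => memBV_of_contDiff hΩ (hv k) (hvc k) (hvs k), ?_,
    fun E hE hEc hEΩ hfr => ?_⟩
  · refine tendsto_of_tendsto_of_tendsto_of_le_of_le tendsto_const_nhds ?_ (fun _ => zero_le) hvφ
    have := ENNReal.tendsto_ofReal (tendsto_one_div_add_atTop_nhds_zero_nat (𝕜 := ℝ))
    rwa [ENNReal.ofReal_zero] at this
  · rw [ofReal_integral_eq_lintegral_ofReal hf.integrableOn (ae_restrict_of_ae hf0),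
      ← withDensity_apply _ hE]
    refine tendsto_measure_of_tendsto_lintegral_test hΩ hψ hsep (fun j => ?_) hEc hEΩ
      (withDensity_absolutelyContinuous _ _ hfr)
    have hψm : Measurable fun x => ENNReal.ofReal (ψ j x) :=
      (hψ j).contDiff.continuous.measurable.ennreal_ofReal
    have hψ0 : ∀ x, 0 ≤ ψ j x := fun x => ((hψ j).mem_Icc x).1
    have e1 : ∀ k, ∫⁻ x, ENNReal.ofReal (ψ j x) ∂(totalVar Ω (v k)) =
        ENNReal.ofReal (∫ x, ψ j x * ‖∇ (v k) x‖) := by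
      intro k
      have hc := continuous_gradient (hv k)
      rw [totalVar_of_contDiff hΩ (hv k) (hvc k) (hvs k),
        lintegral_withDensity_eq_lintegral_mul _ hc.measurable.enorm hψm,
        ofReal_integral_eq_lintegral_ofReal
          (f := fun x => ψ j x * ‖∇ (v k) x‖)
          (((hψ j).contDiff.continuous.mul hc.norm).integrable_of_hasCompactSupport
            (hψ j).hasCompactSupport.mul_right)
          (Eventually.of_forall fun x => mul_nonneg (hψ0 x) (norm_nonneg _))]
      refine lintegral_congr fun x => ?_
      rw [Pi.mul_apply, ENNReal.ofReal_mul (hψ0 x), ofReal_norm, mul_comm]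
    have e2 : ∫⁻ x, ENNReal.ofReal (ψ j x)
        ∂((totalVar Ω φ).withDensity fun x => ENNReal.ofReal (f x)) =
        ENNReal.ofReal (∫ x, ψ j x * f x ∂(totalVar Ω φ)) := by
      rw [lintegral_withDensity_eq_lintegral_mul₀ hfm hψm.aemeasurable,
        ofReal_integral_eq_lintegral_ofReal]
      · refine lintegral_congr fun x => ?_
        rw [Pi.mul_apply, ENNReal.ofReal_mul (hψ0 x), mul_comm]
      · exact hf.bdd_mul (c := 1) (hψ j).contDiff.continuous.aestronglyMeasurable
          (Eventually.of_forall fun x => by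
            rw [Real.norm_of_nonneg (hψ0 x)]; exact ((hψ j).mem_Icc x).2)
      · exact hf0.mono fun x hx => mul_nonneg (hψ0 x) hx
    simp only [e1, e2]
    refine ENNReal.tendsto_ofReal ?_
    rw [tendsto_iff_dist_tendsto_zero]
    refine squeeze_zero' (Eventually.of_forall fun _ => dist_nonneg) ?_
      (tendsto_one_div_add_atTop_nhds_zero_nat (𝕜 := ℝ))
    filter_upwards [eventually_gt_atTop j] with k hk
    exact hvtest k (ψ j) (Finset.mem_image_of_mem _ (Finset.mem_range.2 hk))
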